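/- \textbf{Shelah's theorem for continuous logic.} Let $T$ be a complete theory in ($[0,1]$-valued) continuous first-order logic for bounded metric structures, and let $\mathcal U$ be a monster model of $T$ (a model that is $\kappa$-saturated and strongly $\kappa$-homogeneous for an uncountable cardinal $\kappa$). Below, $\phi(x,y)$ ranges over formulas without parameters, $x,y$ are finite tuples of variables, and all elements and sequences are in $\mathcal U$; $r\mathbin{\dot-}s=\max(r-s,0)$. Consider the following properties of $T$. \begin{itemize} \item $T$ has OP if for some formula $\phi(x,y)$ there are sequences $(a_i)_{i<\omega}$, $(b_i)_{i<\omega}$ and $\epsilon>0$ with $|\phi(a_i,b_j)-\phi(a_j,b_i)|\ge\epsilon$ for all $i<j$. $T$ is stable if no formula has this property. \item $T$ has IP if for some formula $\phi(x,y)$ there are reals $r<s$ and a sequence $(a_i)_{i<\omega}$ such that for every $S\subseteq\omega$ there is $b$ with $\phi(b,a_i)\le r$ for $i\in S$ and $\phi(b,a_i)\ge s$ for $i\notin S$. $T$ is NIP if it does not have IP. \item $T$ has NSCP if for some formula $\phi(x,y)$ there are an indiscernible sequence $(a_i)_{i<\omega}$, a sequence $(b_i)_{i<\omega}$ and $\epsilon>0$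 such that for every $b$ the sequence $(\phi(b,a_i))_{i<\omega}$ converges, and $\phi(b_j,a_i)+\epsilon<\phi(b_i,a_j)$ for all $i<j$. $T$ is SCP if it does not have NSCP. \item $T$ has the weak strict order property wSOP if there are a formula $\phi(x,y)$ and $\epsilon>0$ such that for every integer $n\ge1$ there are a combination $\psi_n(x,y')$ of instances of $\phi$, a sequence $(a_i)_{i<\omega}$ of tuples of the length of $y'$ that is indiscernible over the parameters of $\psi_n$, and a sequence $(b_i)_{i<\omega}$, such that: for every $b$ the sequence $(\psi_n(b,a_i))_{i<\omega}$ converges; $\psi_n(b,a_i)\mathbin{\dot-}\psi_n(b,a_{i+1})\le\epsilon/n$ for all $i$ and all $b$; and $\psi_n(b_j,a_i)+\epsilon<\psi_n(b_i,a_j)$ for all $i<j$. Here a combination of instances of $\phi$ is $\psi(x,y')=\theta(\phi(x,d_1),\dots,\phi(x,d_m))$, where $m\in\mathbb N$, $\theta:[0,1]^m\to[0,1]$ is continuous, $y'$ is a finite tuple of variables (whose length may depend on $n$), and every entry of each tuple $d_l$ is a variable of $y'$ or one of finitely many parameters from $\mathcal U$. $T$ is NwSOP if it does not have wSOP. \end{itemize}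 Then: \begin{enumerate} \item if $T$ is NIP and NwSOP, then $T$ is stable; \item $T$ is NwSOP if and only if $T$ is SCP; \item $T$ has OP if and only if $T$ has IP or wSOP. \end{enumerate} -/

import Mathlib

/-! # Continuous first-order logic for bounded metric structures -/

universe u v w z

namespace ContLogic

set_option linter.checkUnivs false

/-- A (one-sorted) signature of continuous logic: function and predicate symbols with finite
arities, each with a modulus of uniform continuity.  As usual, predicates take values in `[0,1]` and
metrics are bounded by `1`. -/
structure Language where
  Functions : ℕ → Type u
  Predicates : ℕ → Type v
  funMod : ∀ {n : ℕ}, Functions n → ℝ → ℝ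
  funMod_pos : ∀ {n : ℕ} (f : Functions n) (ε : ℝ), 0 < ε → 0 < funMod f ε
  predMod : ∀ {n : ℕ}, Predicates n → ℝ → ℝ
  predMod_pos : ∀ {n : ℕ} (P : Predicates n) (ε : ℝ), 0 < ε → 0 < predMod P ε

/-- An `L`-structure: a nonempty complete metric space of diameter at most `1` with
interpretations of the symbols that respect the moduli of uniform continuity. -/
class Structure (L : Language.{u, v}) (M : Type w) [MetricSpace M] where
  complete : CompleteSpace M
  nonempty : Nonempty M
  dist_le_one : ∀ a b : M, dist a b ≤ 1
  funMap : ∀ {n : ℕ}, L.Functions n → (Fin n → M) → M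
  predMap : ∀ {n : ℕ}, L.Predicates n → (Fin n → M) → unitInterval
  funMap_unif : ∀ {n : ℕ} (f : L.Functions n) (ε : ℝ), 0 < ε → ∀ a b : Fin n → M,
    (∀ i, dist (a i) (b i) < L.funMod f ε) → dist (funMap f a) (funMap f b) ≤ ε
  predMap_unif : ∀ {n : ℕ} (P : L.Predicates n) (ε : ℝ), 0 < ε → ∀ a b : Fin n → M,
    (∀ i, dist (a i) (b i) < L.predMod P ε) → |(predMap P a : ℝ) - (predMap P b : ℝ)| ≤ ε

/-- Terms with variables from `α`. -/
inductive Term (L : Language.{u, v}) (α : Type z) : Type (max u z)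
  | var : α → Term L α
  | func : ∀ {n : ℕ}, L.Functions n → (Fin n → Term L α) → Term L α

/-- Formulas with free variables from `α` and from `n` further variables that are available for
quantification.  The connectives are all continuous functions `[0,1]^k → [0,1]`, the quantifiers are
`sup` and `inf`. -/
inductive BFormula (L : Language.{u, v}) (α : Type z) : ℕ → Type (max u v z)
  | dist : ∀ {n : ℕ}, Term L (α ⊕ Fin n) → Term L (α ⊕ Fin n) → BFormula L α n
  | pred : ∀ {n k : ℕ}, L.Predicates k → (Fin k → Term L (α ⊕ Fin n)) → BFormula L α n
  | conn : ∀ {n k : ℕ}, C(Fin k → unitInterval, unitInterval) →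
      (Fin k → BFormula L α n) → BFormula L α n
  | sup : ∀ {n : ℕ}, BFormula L α (n + 1) → BFormula L α n
  | inf : ∀ {n : ℕ}, BFormula L α (n + 1) → BFormula L α n

/-- Formulas with free variables from `α`.  An `L(A)`-formula in the variables `β` is a formula with
free variables from `β ⊕ A`, the variables from `A` being interpreted by themselves. -/
abbrev Formula (L : Language.{u, v}) (α : Type z) := BFormula L α 0

abbrev Sentence (L : Language.{u, v}) := Formula L Empty

section Semantics

variable {L : Language.{u, v}} {M : Type w} [MetricSpace M] [Structure L M] {α : Type z}

/-- The interpretation of a term. -/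
def Term.eval (s : α → M) : Term L α → M
  | .var a => s a
  | .func f ts => Structure.funMap f (fun i => (ts i).eval s)

/-- The value in `[0,1]` of a formula. -/
noncomputable def BFormula.eval (s : α → M) : {n : ℕ} → BFormula L α n → (Fin n → M) → unitInterval
  | _, .dist t₁ t₂, e =>
      ⟨Dist.dist (t₁.eval (Sum.elim s e)) (t₂.eval (Sum.elim s e)),
        dist_nonneg, Structure.dist_le_one (L := L) _ _⟩
  | _, .pred P ts, e => Structure.predMap P (fun i => (ts i).eval (Sum.elim s e))
  | _, .conn θ φs, e => θ (fun i => (φs i).eval s e)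
  | _, .sup φ, e => ⨆ a : M, φ.eval s (Fin.snoc e a)
  | _, .inf φ, e => ⨅ a : M, φ.eval s (Fin.snoc e a)

/-- The value of a formula at an assignment of its free variables. -/
noncomputable def Formula.val (φ : Formula L α) (s : α → M) : unitInterval :=
  BFormula.eval s φ Fin.elim0

/-- The real number `φ(b, a)`, for a formula `φ(x, y)` whose free variables are split into two
finite tuples `x` and `y`. -/
noncomputable def Formula.val₂ {p q : ℕ} (φ : Formula L (Fin p ⊕ Fin q)) (b : Fin p → M)
    (a : Fin q → M) : ℝ :=
  (φ.val (Sum.elim b a) : ℝ)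

end Semantics

/-! ### Theories and monster models -/

/-- A theory is a set of closed conditions `σ = 0`. -/
abbrev Theory (L : Language.{u, v}) := Set (Sentence L)

/-- `M ⊨ T`. -/
def Models {L : Language.{u, v}} (M : Type w) [MetricSpace M] [Structure L M]
    (T : Theory L) : Prop :=
  ∀ σ ∈ T, Formula.val σ (Empty.elim : Empty → M) = 0

/-- The set of all closed conditions true in `M`. -/
def fullTheory (L : Language.{u, v}) (M : Type w) [MetricSpace M] [Structure L M] : Theory L :=
  {σ | Formula.val σ (Empty.elim : Empty → M) = 0}

/-- `T` is complete: it is the set of all closed conditions true in some structure. -/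
def Theory.IsComplete {L : Language.{u, v}} (T : Theory L) : Prop :=
  ∃ (M : Type w) (_ : MetricSpace M) (_ : Structure L M), T = fullTheory L M

/-- `κ`-saturation: every finitely satisfiable set of `L(A)`-conditions `φ(x) = 0` in finitely many
variables, with fewer than `κ` parameters, is satisfiable. -/
def IsSaturated (L : Language.{u, v}) (M : Type w) [MetricSpace M] [Structure L M]
    (κ : Cardinal.{w}) : Prop :=
  ∀ A : Set M, Cardinal.mk A < κ → ∀ (n : ℕ) (Γ : Set (Formula L (Fin n ⊕ A))),
    (∀ Δ : Finset (Formula L (Fin n ⊕ A)), (Δ : Set (Formula L (Fin n ⊕ A))) ⊆ Γ →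
      ∃ x : Fin n → M, ∀ φ ∈ Δ, Formula.val φ (Sum.elim x (fun a : A => (a : M))) = 0) →
    ∃ x : Fin n → M, ∀ φ ∈ Γ, Formula.val φ (Sum.elim x (fun a : A => (a : M))) = 0

/-- Automorphisms of a structure. -/
def IsAutomorphism (L : Language.{u, v}) {M : Type w} [MetricSpace M] [Structure L M]
    (g : M ≃ M) : Prop :=
  Isometry g ∧
  (∀ {n : ℕ} (f : L.Functions n) (a : Fin n → M),
    g (Structure.funMap f a) = Structure.funMap f (fun i => g (a i))) ∧
  (∀ {n : ℕ} (P : L.Predicates n) (a : Fin n → M),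
    Structure.predMap P (fun i => g (a i)) = Structure.predMap P a)

/-- Strong `κ`-homogeneity: every elementary map from a subset with fewer than `κ` elements extends
to an automorphism. -/
def IsStronglyHomogeneous (L : Language.{u, v}) (M : Type w) [MetricSpace M] [Structure L M]
    (κ : Cardinal.{w}) : Prop :=
  ∀ A : Set M, Cardinal.mk A < κ → ∀ f : A → M,
    (∀ φ : Formula L A, φ.val f = φ.val (fun a : A => (a : M))) →
    ∃ g : M ≃ M, IsAutomorphism L g ∧ ∀ a : A, g a = f a

/-- `𝒰` is a monster model of `T`: a model of `T` that is `κ`-saturated and strongly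
`κ`-homogeneous for an uncountable cardinal `κ`. -/
def IsMonsterModel {L : Language.{u, v}} (T : Theory L) (𝒰 : Type w) [MetricSpace 𝒰]
    [Structure L 𝒰] : Prop :=
  Models 𝒰 T ∧ ∃ κ : Cardinal.{w}, Cardinal.aleph0 < κ ∧
    IsSaturated L 𝒰 κ ∧ IsStronglyHomogeneous L 𝒰 κ

/-! ### Dividing lines -/

section DividingLines

variable (L : Language.{u, v}) {𝒰 : Type w} [MetricSpace 𝒰] [Structure L 𝒰]

/-- The sequence of `q`-tuples `(a i)` is indiscernible over `A`: increasing subsequences of the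
same finite length satisfy the same `L(A)`-conditions. -/
def IsIndiscernibleOver (A : Set 𝒰) {q : ℕ} (a : ℕ → Fin q → 𝒰) : Prop :=
  ∀ (n : ℕ) (i j : Fin n → ℕ), StrictMono i → StrictMono j →
    ∀ φ : Formula L ((Fin n × Fin q) ⊕ A),
      φ.val (Sum.elim (fun r => a (i r.1) r.2) (fun c : A => (c : 𝒰))) =
        φ.val (Sum.elim (fun r => a (j r.1) r.2) (fun c : A => (c : 𝒰)))

variable {L}

/-- A combination `ψ(x, y)` of instances of a formula `φ(x, y')` with `y'` of length `q`, where `x` is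
unchanged and `y` has length `k`: a continuous connective applied to finitely many instances
`φ(x, d₁), …, φ(x, dₘ)`, where every entry of each tuple `dₗ` is one of the variables of `y` or one of
finitely many parameters. -/
structure Combination (𝒰 : Type w) (q k : ℕ) where
  numParams : ℕ
  params : Fin numParams → 𝒰
  numInst : ℕ
  arg : Fin numInst → Fin q → Fin k ⊕ Fin numParams
  conn : C(Fin numInst → unitInterval, unitInterval)

/-- The real number `ψ(b, a)`, where `ψ` is the combination `C` of instances of `φ`. -/
noncomputable def Combination.val {p q k : ℕ} (C : Combination 𝒰 q k)
    (φ : Formula L (Fin p ⊕ Fin q)) (b : Fin p → 𝒰) (a : Fin k → 𝒰) : ℝ :=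
  (C.conn (fun l => φ.val (Sum.elim b (fun r => Sum.elim a C.params (C.arg l r)))) : ℝ)

variable (𝒰)

/-- The order property of `φ(x, y)`. -/
def FormulaOP {p q : ℕ} (φ : Formula L (Fin p ⊕ Fin q)) : Prop :=
  ∃ (a : ℕ → Fin p → 𝒰) (b : ℕ → Fin q → 𝒰) (ε : ℝ), 0 < ε ∧
    ∀ i j, i < j → ε ≤ |φ.val₂ (a i) (b j) - φ.val₂ (a j) (b i)|

/-- The independence property of `φ(x, y)`. -/
def FormulaIP {p q : ℕ} (φ : Formula L (Fin p ⊕ Fin q)) : Prop :=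
  ∃ (r s : ℝ) (a : ℕ → Fin q → 𝒰), r < s ∧ ∀ S : Set ℕ, ∃ b : Fin p → 𝒰, ∀ i,
    (i ∈ S → φ.val₂ b (a i) ≤ r) ∧ (i ∉ S → s ≤ φ.val₂ b (a i))

/-- Failure of the weak sequential completeness property for `φ(x, y)`. -/
def FormulaNSCP {p q : ℕ} (φ : Formula L (Fin p ⊕ Fin q)) : Prop :=
  ∃ (a : ℕ → Fin q → 𝒰) (b : ℕ → Fin p → 𝒰) (ε : ℝ), 0 < ε ∧
    IsIndiscernibleOver L ∅ a ∧
    (∀ x : Fin p → 𝒰, ∃ l : ℝ,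
      Filter.Tendsto (fun i => φ.val₂ x (a i)) Filter.atTop (nhds l)) ∧
    ∀ i j, i < j → φ.val₂ (b j) (a i) + ε < φ.val₂ (b i) (a j)

/-- The formula `φ(x, y)` makes the weak strict order property. -/
def FormulaWSOP {p q : ℕ} (φ : Formula L (Fin p ⊕ Fin q)) : Prop :=
  ∃ ε : ℝ, 0 < ε ∧ ∀ n : ℕ, 1 ≤ n →
    ∃ (k : ℕ) (ψ : Combination 𝒰 q k) (a : ℕ → Fin k → 𝒰) (b : ℕ → Fin p → 𝒰),
      IsIndiscernibleOver L (Set.range ψ.params) a ∧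
      (∀ x : Fin p → 𝒰, ∃ l : ℝ,
        Filter.Tendsto (fun i => ψ.val φ x (a i)) Filter.atTop (nhds l)) ∧
      (∀ i, ∀ x : Fin p → 𝒰, max (ψ.val φ x (a i) - ψ.val φ x (a (i + 1))) 0 ≤ ε / n) ∧
      ∀ i j, i < j → ψ.val φ (b j) (a i) + ε < ψ.val φ (b i) (a j)

variable (L)

/-- The theory with monster model `𝒰` has OP. -/
def HasOP : Prop := ∃ (p q : ℕ) (φ : Formula L (Fin p ⊕ Fin q)), FormulaOP 𝒰 φ

/-- The theory with monster model `𝒰` has IP. -/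
def HasIP : Prop := ∃ (p q : ℕ) (φ : Formula L (Fin p ⊕ Fin q)), FormulaIP 𝒰 φ

/-- The theory with monster model `𝒰` has NSCP. -/
def HasNSCP : Prop := ∃ (p q : ℕ) (φ : Formula L (Fin p ⊕ Fin q)), FormulaNSCP 𝒰 φ

/-- The theory with monster model `𝒰` has wSOP. -/
def HasWSOP : Prop := ∃ (p q : ℕ) (φ : Formula L (Fin p ⊕ Fin q)), FormulaWSOP 𝒰 φ

/-- NIP: no formula has the independence property. -/
def IsNIP : Prop := ¬ HasIP L 𝒰

/-- SCP: no formula has NSCP. -/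
def IsSCP : Prop := ¬ HasNSCP L 𝒰

/-- NwSOP: no formula makes wSOP. -/
def IsNwSOP : Prop := ¬ HasWSOP L 𝒰

/-- Stability: every formula `φ(x, y)` is stable, that is, for no `ε > 0` are there sequences with
`|φ(aᵢ, bⱼ) - φ(aⱼ, bᵢ)| ≥ ε` for all `i < j`. -/
def IsStable : Prop := ∀ (p q : ℕ) (φ : Formula L (Fin p ⊕ Fin q)), ¬ FormulaOP 𝒰 φ

end DividingLines

end ContLogic

namespace ContLogic

variable {L : Language.{u, v}}

/-- Renaming of the variables of a term. -/
def Term.map {α β : Type*} (g : α → β) : Term L α → Term L β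
  | .var a => .var (g a)
  | .func f ts => .func f (fun i => (ts i).map g)

theorem Term.eval_map {M : Type w} [MetricSpace M] [Structure L M] {α β : Type*} (g : α → β)
    (s : β → M) (t : Term L α) : (t.map g).eval s = t.eval (s ∘ g) := by
  induction t with
  | var a => rfl
  | func f ts ih => simp only [Term.map, Term.eval, ih]

/-- Renaming of the free variables of a formula, where a free variable may become one of `k` new
quantifiable variables. -/
def BFormula.lift {α β : Type*} {k : ℕ} (g : α → β ⊕ Fin k) :
    {n : ℕ} → BFormula L α n → BFormula L β (k + n)
  | n, .dist t₁ t₂ =>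
      .dist (t₁.map (Sum.elim (Sum.map id (Fin.castAdd n) ∘ g) (Sum.inr ∘ Fin.natAdd k)))
        (t₂.map (Sum.elim (Sum.map id (Fin.castAdd n) ∘ g) (Sum.inr ∘ Fin.natAdd k)))
  | n, .pred P ts => .pred P fun i =>
      (ts i).map (Sum.elim (Sum.map id (Fin.castAdd n) ∘ g) (Sum.inr ∘ Fin.natAdd k))
  | _, .conn θ φs => .conn θ fun i => (φs i).lift g
  | _, .sup φ => .sup (φ.lift g)
  | _, .inf φ => .inf (φ.lift g)

/-- Quantification of all quantifiable variables by `inf`. -/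
def BFormula.infAll {α : Type*} : {k : ℕ} → BFormula L α k → Formula L α
  | 0, φ => φ
  | _ + 1, φ => φ.inf.infAll

section Eval

variable {M : Type w} [MetricSpace M] [Structure L M]

theorem BFormula.eval_lift {α β : Type*} {k : ℕ} (g : α → β ⊕ Fin k) (s : β → M) {n : ℕ}
    (φ : BFormula L α n) (e : Fin (k + n) → M) :
    (φ.lift g).eval s e =
      φ.eval (fun a => Sum.elim s (e ∘ Fin.castAdd n) (g a)) (e ∘ Fin.natAdd k) := by
  have key : ∀ {n : ℕ} (e : Fin (k + n) → M),
      Sum.elim s e ∘ Sum.elim (Sum.map id (Fin.castAdd n) ∘ g) (Sum.inr ∘ Fin.natAdd k) =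
        Sum.elim (fun a => Sum.elim s (e ∘ Fin.castAdd n) (g a)) (e ∘ Fin.natAdd k) := by
    intro n e
    funext a
    rcases a with a | i
    · simp only [Function.comp_apply, Sum.elim_inl]
      rcases g a with b | j <;> rfl
    · rfl
  have snoc_castAdd : ∀ {n : ℕ} (e : Fin (k + n) → M) (a : M),
      (Fin.snoc e a : Fin (k + n + 1) → M) ∘ Fin.castAdd (n + 1) = e ∘ Fin.castAdd n := by
    intro n e a
    funext i
    have : Fin.castAdd (n + 1) i = Fin.castSucc (Fin.castAdd n i) := rfl
    simp only [Function.comp_apply, this]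
    exact Fin.snoc_castSucc (α := fun _ => M) _ _ _
  have snoc_natAdd : ∀ {n : ℕ} (e : Fin (k + n) → M) (a : M),
      (Fin.snoc e a : Fin (k + n + 1) → M) ∘ (Fin.natAdd k : Fin (n + 1) → Fin (k + (n + 1))) =
        Fin.snoc (e ∘ Fin.natAdd k) a := by
    intro n e a
    funext i
    refine Fin.lastCases ?_ (fun j => ?_) i
    · have : Fin.natAdd k (Fin.last n) = Fin.last (k + n) := rfl
      simp only [Function.comp_apply, this, Fin.snoc_last]
    · have : Fin.natAdd k j.castSucc = (Fin.natAdd k j).castSucc := rfl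
      simp only [Function.comp_apply, this, Fin.snoc_castSucc]
  induction φ with
  | dist t₁ t₂ => simp only [BFormula.lift, BFormula.eval, Term.eval_map, key]
  | pred P ts => simp only [BFormula.lift, BFormula.eval, Term.eval_map, key]
  | conn θ φs ih => simp only [BFormula.lift, BFormula.eval, ih]
  | sup φ ih =>
    simp only [BFormula.lift, BFormula.eval]
    refine iSup_congr fun a => ?_
    rw [← snoc_natAdd, ← snoc_castAdd e a]
    exact ih _
  | inf φ ih =>
    simp only [BFormula.lift, BFormula.eval]
    refine iInf_congr fun a => ?_
    rw [← snoc_natAdd, ← snoc_castAdd e a]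
    exact ih _

theorem BFormula.val_infAll {α : Type*} (s : α → M) {k : ℕ} (φ : BFormula L α k) :
    φ.infAll.val s = ⨅ x : Fin k → M, φ.eval s x := by
  induction k with
  | zero =>
    rw [iInf_unique]
    exact congrArg (BFormula.eval s φ) (Subsingleton.elim _ _)
  | succ k ih =>
    rw [BFormula.infAll, ih]
    refine le_antisymm (le_iInf fun x => ?_) (le_iInf fun x => le_iInf fun a => iInf_le _ _)
    refine (iInf_le _ (Fin.init x)).trans ((iInf_le _ (x (Fin.last k))).trans_eq ?_)
    rw [Fin.snoc_init_self]

end Eval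

/-! ### Definable functions -/

variable (L) {M : Type w} [MetricSpace M] [Structure L M]

/-- The function `f` is given by a formula without parameters. -/
def IsDefinable {α : Type*} (f : (α → M) → unitInterval) : Prop :=
  ∃ φ : Formula L α, ∀ s, φ.val s = f s

/-- The function `f` is given by a formula with parameters from `A`. -/
def IsDefinableOver (A : Set M) {α : Type*} (f : (α → M) → unitInterval) : Prop :=
  ∃ φ : Formula L (α ⊕ A), ∀ s, φ.val (Sum.elim s fun c : A => (c : M)) = f s

variable {L}

theorem Formula.isDefinable {α : Type*} (φ : Formula L α) :
    IsDefinable L (M := M) (fun s => φ.val s) := ⟨φ, fun _ => rfl⟩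

theorem IsDefinable.comp {α β : Type*} {f : (α → M) → unitInterval} (hf : IsDefinable L f)
    (g : α → β) : IsDefinable L (fun s : β → M => f (s ∘ g)) := by
  obtain ⟨φ, hφ⟩ := hf
  refine ⟨φ.lift (k := 0) (fun a => Sum.inl (g a)), fun s => ?_⟩
  refine (BFormula.eval_lift _ s φ _).trans (Eq.trans ?_ (hφ _))
  exact congrArg (BFormula.eval _ φ) (Subsingleton.elim _ _)

theorem IsDefinable.conn {ι α : Type*} [Fintype ι] {f : ι → (α → M) → unitInterval}
    (hf : ∀ i, IsDefinable L (f i)) {θ : (ι → unitInterval) → unitInterval} (hθ : Continuous θ) :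
    IsDefinable L (fun s => θ fun i => f i s) := by
  choose φ hφ using hf
  let e := Fintype.equivFin ι
  refine ⟨.conn ⟨fun v => θ (v ∘ e), by fun_prop⟩ (fun i => φ (e.symm i)), fun s => ?_⟩
  refine congrArg θ (funext fun i => ?_)
  rw [← hφ]
  simp [Formula.val]

theorem IsDefinable.iInf {β : Type*} {p : ℕ} {f : (β ⊕ Fin p → M) → unitInterval}
    (hf : IsDefinable L f) :
    IsDefinable L (fun s : β → M => ⨅ x : Fin p → M, f (Sum.elim s x)) := by
  obtain ⟨φ, hφ⟩ := hf
  refine ⟨(φ.lift (k := p) id).infAll, fun s => ?_⟩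
  refine (BFormula.val_infAll s (k := p) _).trans (iInf_congr fun x => ?_)
  rw [← hφ]
  refine (BFormula.eval_lift id s φ x).trans ?_
  have h : (fun a => Sum.elim s (x ∘ Fin.castAdd 0) (id a)) = Sum.elim s x := rfl
  rw [h]
  exact congrArg (BFormula.eval _ φ) (Subsingleton.elim _ _)

theorem IsDefinableOver.iff {A : Set M} {α : Type*} {f : (α → M) → unitInterval} :
    IsDefinableOver L A f ↔ ∃ F : (α ⊕ A → M) → unitInterval, IsDefinable L F ∧
      ∀ s, f s = F (Sum.elim s fun c : A => (c : M)) :=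
  ⟨fun ⟨φ, h⟩ => ⟨_, φ.isDefinable, fun s => (h s).symm⟩,
    fun ⟨_, ⟨φ, hφ⟩, h⟩ => ⟨φ, fun s => by rw [hφ, h]⟩⟩

theorem IsDefinable.over {α β : Type*} {f : (α → M) → unitInterval} (hf : IsDefinable L f)
    {A : Set M} (g : α → β ⊕ A) :
    IsDefinableOver L A (fun s : β → M => f fun a => Sum.elim s (fun c : A => (c : M)) (g a)) :=
  IsDefinableOver.iff.2 ⟨_, hf.comp g, fun _ => rfl⟩

theorem IsDefinableOver.comp {α β : Type*} {A B : Set M} {f : (α → M) → unitInterval}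
    (hf : IsDefinableOver L A f) (hAB : A ⊆ B) (g : α → β ⊕ B) :
    IsDefinableOver L B (fun s : β → M => f fun a => Sum.elim s (fun c : B => (c : M)) (g a)) := by
  obtain ⟨F, hF, h⟩ := IsDefinableOver.iff.1 hf
  refine IsDefinableOver.iff.2 ⟨_, hF.comp (Sum.elim g fun c => .inr ⟨c, hAB c.2⟩), fun s => ?_⟩
  rw [h]
  refine congrArg F (funext fun a => ?_)
  rcases a with a | a <;> rfl

theorem IsDefinableOver.conn {ι α : Type*} [Fintype ι] {A : Set M}
    {f : ι → (α → M) → unitInterval} (hf : ∀ i, IsDefinableOver L A (f i))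
    {θ : (ι → unitInterval) → unitInterval} (hθ : Continuous θ) :
    IsDefinableOver L A (fun s => θ fun i => f i s) := by
  choose F hF h using fun i => IsDefinableOver.iff.1 (hf i)
  exact IsDefinableOver.iff.2 ⟨_, IsDefinable.conn hF hθ, fun s => by simp only [h]⟩

theorem IsDefinableOver.conn₁ {α : Type*} {A : Set M} {f : (α → M) → unitInterval}
    (hf : IsDefinableOver L A f) {θ : unitInterval → unitInterval} (hθ : Continuous θ) :
    IsDefinableOver L A (fun s => θ (f s)) :=
  IsDefinableOver.conn (ι := Unit) (f := fun _ => f) (fun _ => hf) (θ := fun v => θ (v ()))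
    (by fun_prop)

/-! ### Saturation -/

/-- Finitely satisfiable sets of conditions over countable sets are satisfiable. -/
def IsCountablySaturated (L : Language.{u, v}) (M : Type w) [MetricSpace M] [Structure L M] : Prop :=
  ∃ κ : Cardinal.{w}, Cardinal.aleph0 < κ ∧ IsSaturated L M κ

theorem IsMonsterModel.isCountablySaturated {T : Theory L} (h : IsMonsterModel T M) :
    IsCountablySaturated L M :=
  let ⟨κ, h₁, h₂, _⟩ := h.2
  ⟨κ, h₁, h₂⟩

theorem IsCountablySaturated.exists_forall_eq_zero (hM : IsCountablySaturated L M) {ι K : Type*}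
    [Finite ι] {A : Set M} (hA : A.Countable) {f : K → (ι → M) → unitInterval}
    (hf : ∀ k, IsDefinableOver L A (f k))
    (h : ∀ (t : Finset K) (ε : ℝ), 0 < ε → ∃ x, ∀ k ∈ t, (f k x : ℝ) ≤ ε) :
    ∃ x, ∀ k, f k x = 0 := by
  classical
  obtain ⟨κ, hκ, hs⟩ := hM
  obtain ⟨n, ⟨e⟩⟩ := Finite.exists_equiv_fin ι
  let trunc (m : ℕ) (x : unitInterval) : unitInterval :=
    Set.projIcc 0 1 zero_le_one ((x : ℝ) - 1 / (m + 1))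
  have trunc_zero (m : ℕ) (x : unitInterval) : trunc m x = 0 ↔ (x : ℝ) ≤ 1 / (m + 1) := by
    change Set.projIcc (0 : ℝ) 1 zero_le_one _ = ⟨0, _⟩ ↔ _
    rw [Set.projIcc_eq_left zero_lt_one, sub_nonpos]
  have hdef : ∀ (k : K) (m : ℕ), IsDefinableOver L A
      (fun x : Fin n → M => trunc m (f k (x ∘ e))) := by
    intro k m
    have h₁ := (hf k).comp (le_refl A) (fun i => (Sum.inl (e i) : Fin n ⊕ A))
    exact h₁.conn₁ (by fun_prop)
  choose φ hφ using hdef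
  obtain ⟨x, hx⟩ := hs A (hA.le_aleph0.trans_lt hκ) n (Set.range fun km : K × ℕ => φ km.1 km.2) (by
    intro Δ hΔ
    choose c hc using fun ψ : Δ => hΔ ψ.2
    obtain ⟨N, hN⟩ := (Finset.univ.image fun ψ => (c ψ).2).bddAbove
    obtain ⟨x, hx⟩ := h (Finset.univ.image fun ψ => (c ψ).1) (1 / (N + 1)) (by positivity)
    refine ⟨x ∘ e.symm, fun ψ hψ => ?_⟩
    lift ψ to Δ using hψ
    rw [← hc ψ]
    refine (hφ _ _ _).trans ((trunc_zero _ _).2 ?_)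
    have h₁ := hx _ (Finset.mem_image_of_mem _ (Finset.mem_univ ψ))
    have h₂ : (c ψ).2 ≤ N :=
      hN (Finset.mem_coe.2 (Finset.mem_image_of_mem _ (Finset.mem_univ ψ)))
    have h₃ : (x ∘ e.symm) ∘ e = x := by ext; simp
    rw [h₃]
    refine h₁.trans ?_
    gcongr)
  refine ⟨x ∘ e, fun k => Subtype.ext (le_antisymm ?_ (f k _).2.1)⟩
  refine ge_of_tendsto' (tendsto_one_div_add_atTop_nhds_zero_nat (𝕜 := ℝ)) fun m => ?_
  exact (trunc_zero m _).1 ((hφ k m x).symm.trans (hx _ ⟨(k, m), rfl⟩))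

/-! ### Indiscernible sequences -/

theorem projIcc_le {y ε : ℝ} (hε : 0 ≤ ε) (hy : y ≤ ε) :
    (Set.projIcc (0 : ℝ) 1 zero_le_one y : ℝ) ≤ ε := by
  rw [Set.coe_projIcc]
  exact max_le hε ((min_le_right _ _).trans hy)

theorem projIcc_eq_zero {y : ℝ} : Set.projIcc (0 : ℝ) 1 zero_le_one y = 0 ↔ y ≤ 0 := by
  change Set.projIcc (0 : ℝ) 1 zero_le_one _ = ⟨0, _⟩ ↔ _
  rw [Set.projIcc_eq_left zero_lt_one]

/-- The average type of a sequence along an ultrafilter is realized over countable sets. -/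
theorem IsCountablySaturated.exists_tendsto (hM : IsCountablySaturated L M) {ι : Type z} [Finite ι]
    (e : ℕ → ι → M) (U : Ultrafilter ℕ) {B : Set M} (hB : B.Countable) :
    ∃ c : ι → M, ∀ f : (ι → M) → unitInterval, IsDefinableOver L B f →
      Filter.Tendsto (fun j => f (e j)) U (nhds (f c)) := by
  have hlim : ∀ f : (ι → M) → unitInterval, ∃ l, Filter.Tendsto (fun j => f (e j)) U (nhds l) :=
    fun f => ⟨_, (U.map fun j => f (e j)).le_nhds_lim⟩
  choose l hl using hlim
  obtain ⟨c, hc⟩ := hM.exists_forall_eq_zero hB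
    (K := {f : (ι → M) → unitInterval // IsDefinableOver L B f})
    (f := fun f x => Set.projIcc 0 1 zero_le_one |(f.1 x : ℝ) - l f.1|)
    (fun f => f.2.conn₁ (θ := fun y => Set.projIcc 0 1 zero_le_one |(y : ℝ) - l f.1|)
      (by fun_prop)) (by
      intro t ε hε
      have : ∀ᶠ j in (U : Filter ℕ), ∀ f ∈ t, |(f.1 (e j) : ℝ) - l f.1| < ε := by
        rw [Filter.eventually_all_finset]
        intro f _
        exact (hl f.1).eventually (Metric.ball_mem_nhds _ hε)
      obtain ⟨j, hj⟩ := this.exists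
      exact ⟨e j, fun f hf => projIcc_le hε.le (hj f hf).le⟩)
  refine ⟨c, fun f hf => ?_⟩
  have h := projIcc_eq_zero.1 (hc ⟨f, hf⟩)
  have h' : f c = l f := Subtype.ext (sub_eq_zero.1 (abs_nonpos_iff.1 h))
  rw [h']
  exact hl f

variable (L) in
/-- The sequence of tuples `(a i)`, indexed by a linear order, is indiscernible. -/
def IsIndiscernible {J : Type*} [LinearOrder J] {ι : Type*} (a : J → ι → M) : Prop :=
  ∀ (n : ℕ) (F : (Fin n × ι → M) → unitInterval), IsDefinable L F →
    ∀ i j : Fin n → J, StrictMono i → StrictMono j →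
      F (fun r => a (i r.1) r.2) = F (fun r => a (j r.1) r.2)

theorem isIndiscernibleOver_empty_iff {q : ℕ} {a : ℕ → Fin q → M} :
    IsIndiscernibleOver L ∅ a ↔ IsIndiscernible L a := by
  constructor
  · intro h n F hF i j hi hj
    obtain ⟨φ, hφ⟩ := hF.over (A := (∅ : Set M)) Sum.inl
    have := h n i j hi hj φ
    rwa [hφ, hφ] at this
  · intro h n i j hi hj φ
    have h₁ := (φ.isDefinable (M := M)).comp (fun x => x.elim id fun c : (∅ : Set M) => c.2.elim)
    have h₂ := h n _ h₁ i j hi hj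
    have h₃ : ∀ s : Fin n × Fin q → M,
        s ∘ (fun x => x.elim id fun c : (∅ : Set M) => c.2.elim) =
          Sum.elim s fun c : (∅ : Set M) => (c : M) := by
      intro s
      funext x
      rcases x with x | x
      · rfl
      · exact x.2.elim
    simpa only [h₃] using h₂

/-- A sequence whose terms realize the average type of `e` over `B` and the preceding terms. -/
theorem IsCountablySaturated.exists_coheir_sequence (hM : IsCountablySaturated L M) {ι : Type z}
    [Finite ι] (e : ℕ → ι → M) (U : Ultrafilter ℕ) {B : Set M} (hB : B.Countable) :
    ∃ (c : ℕ → ι → M) (D : ℕ → Set M), (∀ n, B ⊆ D n) ∧ (∀ m n, m < n → Set.range (c m) ⊆ D n) ∧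
      ∀ n (f : (ι → M) → unitInterval), IsDefinableOver L (D n) f →
        Filter.Tendsto (fun j => f (e j)) U (nhds (f (c n))) := by
  choose nxt hnxt using fun B : {B : Set M // B.Countable} => hM.exists_tendsto e U B.2
  let D : ℕ → {B : Set M // B.Countable} := fun n =>
    n.rec ⟨B, hB⟩ fun _ D => ⟨D.1 ∪ Set.range (nxt D), D.2.union (Set.countable_range _)⟩
  have hD : Monotone fun n => (D n).1 :=
    monotone_nat_of_le_succ fun n => Set.subset_union_left
  refine ⟨fun n => nxt (D n), fun n => (D n).1, fun n => hD (Nat.zero_le n), fun m n hmn => ?_,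
    fun n => hnxt (D n)⟩
  exact (Set.subset_union_right : _ ⊆ (D (m + 1)).1).trans (hD hmn)

theorem IsCountablySaturated.exists_indiscernible (hM : IsCountablySaturated L M) {ι : Type z}
    [Finite ι] (e : ℕ → ι → M) {G : (ι ⊕ ι → M) → unitInterval} (hG : IsDefinable L G) {ε : ℝ}
    (he : ∀ i j, i < j →
      ε ≤ |(G (Sum.elim (e i) (e j)) : ℝ) - G (Sum.elim (e j) (e i))|) :
    ∃ c : ℕ → ι → M, IsIndiscernible L c ∧ ∀ i j, i < j →
      ε ≤ |(G (Sum.elim (c i) (c j)) : ℝ) - G (Sum.elim (c j) (c i))| := by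
  let U : Ultrafilter ℕ := Filter.hyperfilter ℕ
  let B : Set M := ⋃ j, Set.range (e j)
  have hB : B.Countable := Set.countable_iUnion fun j => Set.countable_range _
  have heB : ∀ j x, e j x ∈ B := fun j x => Set.mem_iUnion.2 ⟨j, x, rfl⟩
  obtain ⟨c, D, hBD, hcD, hc⟩ := hM.exists_coheir_sequence e U hB
  have hdef : ∀ {A : Set M} (d : ι → M), (∀ x, d x ∈ A) →
      IsDefinableOver L A (fun s => G (Sum.elim d s)) ∧
        IsDefinableOver L A (fun s => G (Sum.elim s d)) := by
    intro A d hd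
    constructor
    · convert hG.over (A := A) (β := ι) (Sum.elim (fun x => .inr ⟨d x, hd x⟩) .inl) using 2 with s
      congr 1
      funext x
      rcases x with x | x <;> rfl
    · convert hG.over (A := A) (β := ι) (Sum.elim .inl (fun x => .inr ⟨d x, hd x⟩)) using 2 with s
      congr 1
      funext x
      rcases x with x | x <;> rfl
  have htend : ∀ n (d : ι → M), (∀ x, d x ∈ D n) →
      Filter.Tendsto (fun j => |(G (Sum.elim d (e j)) : ℝ) - G (Sum.elim (e j) d)|) U
        (nhds |(G (Sum.elim d (c n)) : ℝ) - G (Sum.elim (c n) d)|) := by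
    intro n d hd
    have h₁ := (continuous_subtype_val.tendsto _).comp (hc n _ (hdef d hd).1)
    have h₂ := (continuous_subtype_val.tendsto _).comp (hc n _ (hdef d hd).2)
    exact (h₁.sub h₂).abs
  have hce : ∀ n i, ε ≤ |(G (Sum.elim (e i) (c n)) : ℝ) - G (Sum.elim (c n) (e i))| := by
    intro n i
    refine ge_of_tendsto (htend n (e i) fun x => hBD n (heB i x)) ?_
    have : ∀ᶠ j in (U : Filter ℕ), i < j :=
      Filter.Tendsto.eventually_gt_atTop
        (Filter.tendsto_id.mono_left Nat.hyperfilter_le_atTop) i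
    exact this.mono fun j hj => he i j hj
  refine ⟨c, ?_, fun i j hij => ?_⟩
  · suffices h : ∀ (n : ℕ) (F : (Fin n × ι → M) → unitInterval), IsDefinableOver L B F →
        ∀ i j : Fin n → ℕ, StrictMono i → StrictMono j →
          F (fun r => c (i r.1) r.2) = F (fun r => c (j r.1) r.2) from
      fun n F hF => h n F (hF.over (A := B) Sum.inl)
    intro n
    induction n with
    | zero =>
      intro F _ i j _ _
      exact congrArg F (funext fun r => r.1.elim0)
    | succ n ih =>
      intro F hF i j hi hj
      let split (s : Fin n × ι → M) (d : ι → M) : Fin (n + 1) × ι → M :=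
        fun r => Fin.lastCases (motive := fun _ => M) (d r.2) (fun m => s (m, r.2)) r.1
      have hsplit : ∀ i : Fin (n + 1) → ℕ, (fun r : Fin (n + 1) × ι => c (i r.1) r.2) =
          split (fun r => c (i r.1.castSucc) r.2) (c (i (Fin.last n))) := by
        intro i
        funext ⟨m, x⟩
        refine Fin.lastCases ?_ (fun m => ?_) m <;> simp [split]
      have hF₁ : ∀ j, IsDefinableOver L B (fun s => F (split s (e j))) := by
        intro j
        convert hF.comp (le_refl B) (fun r : Fin (n + 1) × ι =>
          Fin.lastCases (motive := fun _ => (Fin n × ι) ⊕ B) (.inr ⟨e j r.2, heB j r.2⟩)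
            (fun m => .inl (m, r.2)) r.1) using 2 with s
        congr 1
        funext ⟨m, x⟩
        refine Fin.lastCases ?_ (fun m => ?_) m <;> simp [split]
      have hF₂ : ∀ i : Fin (n + 1) → ℕ, StrictMono i →
          Filter.Tendsto (fun k => F (split (fun r => c (i r.1.castSucc) r.2) (e k))) U
            (nhds (F fun r => c (i r.1) r.2)) := by
        intro i hi
        rw [hsplit]
        refine hc _ (fun d => F (split (fun r => c (i r.1.castSucc) r.2) d)) ?_
        convert hF.comp (hBD (i (Fin.last n))) (fun r : Fin (n + 1) × ι =>
          Fin.lastCases (motive := fun _ => ι ⊕ D (i (Fin.last n))) (.inl r.2)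
            (fun m => .inr ⟨c (i m.castSucc) r.2,
              hcD _ _ (hi (Fin.castSucc_lt_last m)) ⟨r.2, rfl⟩⟩) r.1) using 2 with s
        congr 1
        funext ⟨m, x⟩
        refine Fin.lastCases ?_ (fun m => ?_) m <;> simp [split]
      refine tendsto_nhds_unique (hF₂ i hi) ((hF₂ j hj).congr fun k => ?_)
      exact (ih _ (hF₁ k) (fun m => i m.castSucc) (fun m => j m.castSucc)
        (hi.comp Fin.strictMono_castSucc) (hj.comp Fin.strictMono_castSucc)).symm
  · refine ge_of_tendsto' (htend j (c i) fun x => hcD i j hij ⟨x, rfl⟩) fun k => ?_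
    rw [abs_sub_comm]
    exact hce i k

theorem IsIndiscernible.comp {J : Type*} [LinearOrder J] {ι κ : Type*} {a : J → ι → M}
    (ha : IsIndiscernible L a) (g : κ → ι) : IsIndiscernible L fun j => a j ∘ g :=
  fun n _ hF => ha n _ (hF.comp (Prod.map id g))

/-! ### Patterns of values along an indiscernible sequence -/

/-- An upper or a lower bound for a real number. -/
inductive Letter : Type
  | lo (t : ℝ)
  | hi (t : ℝ)

/-- The amount by which a real number violates a bound. -/
def Letter.viol : Letter → ℝ → ℝ
  | .lo t, y => y - t
  | .hi t, y => t - y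

theorem Letter.continuous_viol (l : Letter) : Continuous l.viol := by
  cases l with
  | lo t => exact continuous_id.sub continuous_const
  | hi t => exact continuous_const.sub continuous_id

section Patterns

variable {J : Type*} [LinearOrder J] {p q : ℕ} {a : J → Fin q → M}

theorem IsIndiscernible.exists_viol_le (ha : IsIndiscernible L a) (φ : Formula L (Fin p ⊕ Fin q))
    {n : ℕ} (l : Fin n → Letter) {η η' : ℝ} (h₀ : 0 ≤ η) (h : η < η') (h₁ : η' ≤ 1)
    {i j : Fin n → J} (hi : StrictMono i) (hj : StrictMono j) {x : Fin p → M}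
    (hx : ∀ m, (l m).viol (φ.val₂ x (a (i m))) ≤ η) :
    ∃ x' : Fin p → M, ∀ m, (l m).viol (φ.val₂ x' (a (j m))) ≤ η' := by
  let F (s : Fin n × Fin q → M) (x : Fin p → M) : unitInterval :=
    Finset.univ.sup fun m =>
      Set.projIcc (0 : ℝ) 1 zero_le_one ((l m).viol (φ.val₂ x fun r => s (m, r)))
  have hF : IsDefinable L (fun s => ⨅ x, F s x) := by
    have h₁ : ∀ m : Fin n, IsDefinable L fun s : (Fin n × Fin q) ⊕ Fin p → M =>
        φ.val (s ∘ Sum.elim .inr fun r => .inl (m, r)) := fun m =>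
      φ.isDefinable.comp _
    have h₂ := IsDefinable.conn h₁ (θ := fun y => Finset.univ.sup fun m =>
      Set.projIcc (0 : ℝ) 1 zero_le_one ((l m).viol (y m))) (by
        refine Continuous.finset_sup_apply fun m _ => ?_
        have := (l m).continuous_viol
        fun_prop)
    convert IsDefinable.iInf h₂ using 5 with s x
    funext m
    congr 3
    simp only [Formula.val₂]
    congr 2
    funext r
    rcases r with r | r <;> rfl
  have hη : 0 ≤ η' := (h₀.trans_lt h).le
  let η₁ : unitInterval := ⟨η, h₀, (h.trans_le h₁).le⟩
  let η₂ : unitInterval := ⟨η', hη, h₁⟩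
  have key : ⨅ x, F (fun r => a (j r.1) r.2) x < η₂ := by
    rw [← ha n _ hF i j hi hj]
    refine lt_of_le_of_lt (iInf_le _ x) (lt_of_le_of_lt ?_ (show η₁ < η₂ from h))
    exact Finset.sup_le fun m _ => projIcc_le h₀ (hx m)
  obtain ⟨x', hx'⟩ := iInf_lt_iff.1 key
  refine ⟨x', fun m => ?_⟩
  have h₂ : (Set.projIcc (0 : ℝ) 1 zero_le_one ((l m).viol (φ.val₂ x' (a (j m)))) : ℝ) < η' :=
    show _ < η₂ from lt_of_le_of_lt (Finset.le_sup (f := fun m => Set.projIcc (0 : ℝ) 1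
      zero_le_one ((l m).viol (φ.val₂ x' (a (j m))))) (Finset.mem_univ m)) hx'
  rw [Set.coe_projIcc] at h₂
  have h₃ := (le_max_right _ _).trans_lt h₂
  rcases min_lt_iff.1 h₃ with h₄ | h₄
  · exact absurd h₄ h₁.not_gt
  · exact h₄.le

end Patterns

theorem IsCountablySaturated.exists_viol_le_zero (hM : IsCountablySaturated L M)
    {J K : Type*} [Countable K] {p q : ℕ} {φ : Formula L (Fin p ⊕ Fin q)} {a : J → Fin q → M}
    (l : K → Letter) (j : K → J)
    (h : ∀ (t : Finset K) (ε : ℝ), 0 < ε → ∃ x, ∀ k ∈ t, (l k).viol (φ.val₂ x (a (j k))) ≤ ε) :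
    ∃ x, ∀ k, (l k).viol (φ.val₂ x (a (j k))) ≤ 0 := by
  obtain ⟨x, hx⟩ := hM.exists_forall_eq_zero (ι := Fin p) (A := ⋃ k, Set.range (a (j k)))
    (Set.countable_iUnion fun k => Set.countable_range _)
    (f := fun k x => Set.projIcc (0 : ℝ) 1 zero_le_one ((l k).viol (φ.val₂ x (a (j k)))))
    (fun k => by
      have h₁ := (φ.isDefinable (M := M)).over (A := ⋃ k, Set.range (a (j k))) (β := Fin p)
        (Sum.elim .inl fun r => .inr ⟨a (j k) r, Set.mem_iUnion.2 ⟨k, r, rfl⟩⟩)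
      have hc := (l k).continuous_viol
      convert h₁.conn₁ (θ := fun y => Set.projIcc (0 : ℝ) 1 zero_le_one ((l k).viol y))
        (by fun_prop) using 4 with x
      simp only [Formula.val₂]
      congr 2
      funext r
      rcases r with r | r <;> rfl)
    (fun t ε hε => (h t ε hε).imp fun x hx k hk => projIcc_le hε.le (hx k hk))
  exact ⟨x, fun k => projIcc_eq_zero.1 (hx k)⟩

/-! ### NIP and convergence -/

theorem formula_val₂_mem {p q : ℕ} (φ : Formula L (Fin p ⊕ Fin q)) (x : Fin p → M)
    (y : Fin q → M) : φ.val₂ x y ∈ Set.Icc (0 : ℝ) 1 := (φ.val (Sum.elim x y)).2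

theorem IsIndiscernible.exists_tendsto (hM : IsCountablySaturated L M) {p q : ℕ}
    {φ : Formula L (Fin p ⊕ Fin q)} (hφ : ¬ FormulaIP M φ) {a : ℕ → Fin q → M}
    (ha : IsIndiscernible L a) (x : Fin p → M) :
    ∃ l : ℝ, Filter.Tendsto (fun i => φ.val₂ x (a i)) Filter.atTop (nhds l) := by
  refine tendsto_of_no_upcrossings dense_univ ?_ ?_ ?_
  · rintro r - s - hrs ⟨hr, hs⟩
    refine hφ ⟨r, s, a, hrs, fun S => ?_⟩
    classical
    let l (i : ℕ) : Letter := if i ∈ S then .lo r else .hi s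
    obtain ⟨i, hi, hix⟩ := Filter.extraction_forall_of_frequently
      (P := fun n k => (l n).viol (φ.val₂ x (a k)) ≤ 0) (by
        intro n
        by_cases hn : n ∈ S
        · simpa [l, hn, Letter.viol] using hr.mono fun k hk => hk.le
        · simpa [l, hn, Letter.viol] using hs.mono fun k hk => hk.le)
    obtain ⟨b, hb⟩ := hM.exists_viol_le_zero (φ := φ) (a := a) l id (by
      intro t ε hε
      obtain ⟨N, hN⟩ := t.bddAbove
      obtain ⟨x', hx'⟩ := ha.exists_viol_le φ (n := N + 1) (fun m => l m) le_rfl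
        (lt_min hε one_pos) (min_le_right _ _) (i := fun m => i m) (j := fun m => m)
        (hi.comp Fin.val_strictMono) Fin.val_strictMono (x := x) fun m => hix m
      exact ⟨x', fun k hk => (hx' ⟨k, Nat.lt_succ_of_le (hN hk)⟩).trans (min_le_left _ _)⟩)
    refine ⟨b, fun k => ⟨fun hk => ?_, fun hk => ?_⟩⟩
    · simpa [l, hk, Letter.viol] using hb k
    · simpa [l, hk, Letter.viol] using hb k
  · exact Filter.isBoundedUnder_of ⟨1, fun i => (formula_val₂_mem φ x (a i)).2⟩
  · exact Filter.isBoundedUnder_of ⟨0, fun i => (formula_val₂_mem φ x (a i)).1⟩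

/-! ### Implications between the properties -/

theorem FormulaIP.formulaOP {p q : ℕ} {φ : Formula L (Fin p ⊕ Fin q)} (h : FormulaIP M φ) :
    FormulaOP M φ := by
  obtain ⟨r, s, a, hrs, h⟩ := h
  choose b hb using fun j : ℕ => h {i | i < j}
  refine ⟨b, a, s - r, sub_pos.2 hrs, fun i j hij => ?_⟩
  have h₁ := (hb i j).2 (by simpa using hij.le)
  have h₂ := (hb j i).1 hij
  exact le_trans (by linarith) (le_abs_self _)

theorem FormulaNSCP.formulaOP {p q : ℕ} {φ : Formula L (Fin p ⊕ Fin q)} (h : FormulaNSCP M φ) :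
    FormulaOP M φ := by
  obtain ⟨a, b, ε, hε, -, -, h⟩ := h
  exact ⟨b, a, ε, hε, fun i j hij => le_trans (by linarith [h i j hij]) (le_abs_self _)⟩

/-- The formula `1 - φ`. -/
def Formula.compl {α : Type*} (φ : Formula L α) : Formula L α :=
  .conn (k := 1) ⟨fun v => unitInterval.symm (v 0), by fun_prop⟩ fun _ => φ

theorem Formula.val₂_compl {p q : ℕ} (φ : Formula L (Fin p ⊕ Fin q)) (x : Fin p → M)
    (y : Fin q → M) : φ.compl.val₂ x y = 1 - φ.val₂ x y := rfl

theorem hasNSCP_of_hasOP (hM : IsCountablySaturated L M) (hIP : ¬ HasIP L M) (hOP : HasOP L M) :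
    HasNSCP L M := by
  obtain ⟨p, q, φ, a, b, ε, hε, hab⟩ := hOP
  let g : Fin p ⊕ Fin q → (Fin p ⊕ Fin q) ⊕ (Fin p ⊕ Fin q) :=
    Sum.elim (fun x => .inl (.inl x)) (fun y => .inr (.inr y))
  have hg : ∀ s t : Fin p ⊕ Fin q → M,
      (φ.val (Sum.elim s t ∘ g) : ℝ) = φ.val₂ (s ∘ Sum.inl) (t ∘ Sum.inr) := by
    intro s t
    rw [Formula.val₂]
    congr 2
    funext x
    rcases x with x | x <;> rfl
  obtain ⟨c, hc, hcε⟩ := hM.exists_indiscernible (fun i => Sum.elim (a i) (b i))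
    (φ.isDefinable.comp g) (ε := ε) (by
      intro i j hij
      simpa only [hg, Sum.elim_comp_inl, Sum.elim_comp_inr] using hab i j hij)
  simp only [hg] at hcε
  have hconst : ∀ i j, i < j → φ.val₂ (c i ∘ .inl) (c j ∘ .inr) = φ.val₂ (c 0 ∘ .inl) (c 1 ∘ .inr) ∧
      φ.val₂ (c j ∘ .inl) (c i ∘ .inr) = φ.val₂ (c 1 ∘ .inl) (c 0 ∘ .inr) := by
    intro i j hij
    have hm : ∀ i j : ℕ, i < j → StrictMono ![i, j] := by
      intro i j hij
      simp [StrictMono, Fin.forall_fin_two, hij]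
    have key : ∀ k l : Fin 2, φ.val₂ (c (![i, j] k) ∘ .inl) (c (![i, j] l) ∘ .inr) =
        φ.val₂ (c (![0, 1] k) ∘ .inl) (c (![0, 1] l) ∘ .inr) := by
      intro k l
      have := hc 2 _ (φ.isDefinable.comp
        (Sum.elim (fun x => (k, Sum.inl x)) (fun y => (l, Sum.inr y)))) _ _ (hm i j hij)
          (hm 0 1 one_pos)
      have h₁ := congrArg (fun y : unitInterval => (y : ℝ)) this
      simp only [Formula.val₂]
      convert h₁ using 3
      · funext x
        rcases x with x | x <;> rfl
      · funext x
        rcases x with x | x <;> rfl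
    exact ⟨key 0 1, key 1 0⟩
  have hc' := isIndiscernibleOver_empty_iff.2 (hc.comp Sum.inr)
  have h₀ := hcε 0 1 one_pos
  have hlim : ∀ ψ : Formula L (Fin p ⊕ Fin q), ∀ x : Fin p → M, ∃ l : ℝ,
      Filter.Tendsto (fun i => ψ.val₂ x (c i ∘ .inr)) Filter.atTop (nhds l) := fun ψ =>
    IsIndiscernible.exists_tendsto hM (fun h => hIP ⟨p, q, ψ, h⟩) (hc.comp Sum.inr)
  rcases le_abs.1 h₀ with h₁ | h₁
  · refine ⟨p, q, φ, _, fun i => c i ∘ .inl, ε / 2, by positivity, hc', hlim φ, fun i j hij => ?_⟩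
    rw [(hconst i j hij).1, (hconst i j hij).2]
    linarith
  · refine ⟨p, q, φ.compl, _, fun i => c i ∘ .inl, ε / 2, by positivity, hc', hlim _,
      fun i j hij => ?_⟩
    rw [Formula.val₂_compl, Formula.val₂_compl, (hconst i j hij).1, (hconst i j hij).2]
    linarith

theorem HasWSOP.hasNSCP (h : HasWSOP L M) : HasNSCP L M := by
  obtain ⟨p, q, φ, ε, hε, h⟩ := h
  obtain ⟨k, C, a, b, ha, hlim, -, hab⟩ := h 1 le_rfl
  have hdef : IsDefinable L fun s : Fin p ⊕ Fin (k + C.numParams) → M =>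
      C.conn fun l => φ.val (s ∘ Sum.elim .inl fun r =>
        .inr ((C.arg l r).elim (Fin.castAdd _) (Fin.natAdd _))) :=
    IsDefinable.conn (fun l => φ.isDefinable.comp _) C.conn.continuous
  obtain ⟨ψ, hψ⟩ := hdef
  have hval : ∀ x i, ψ.val₂ x (Fin.append (a i) C.params) = C.val φ x (a i) := by
    intro x i
    rw [Formula.val₂, hψ, Combination.val]
    refine congrArg (fun v => (C.conn v : ℝ)) (funext fun l => congrArg φ.val (funext fun r => ?_))
    rcases r with r | r
    · rfl
    · simp only [Function.comp_apply, Sum.elim_inr]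
      rcases C.arg l r with y | y <;> simp
  refine ⟨p, _, ψ, fun i => Fin.append (a i) C.params, b, ε, hε, ?_, fun x => ?_, fun i j hij => ?_⟩
  · rw [isIndiscernibleOver_empty_iff]
    intro n F hF i j hi hj
    let g (r : Fin n × Fin (k + C.numParams)) : (Fin n × Fin k) ⊕ Set.range C.params :=
      Fin.addCases (motive := fun _ => (Fin n × Fin k) ⊕ Set.range C.params)
        (fun x => .inl (r.1, x)) (fun y => .inr ⟨C.params y, y, rfl⟩) r.2
    obtain ⟨χ, hχ⟩ := hF.over g
    have h₁ := ha n i j hi hj χ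
    rw [hχ, hχ] at h₁
    convert h₁ using 2
    · funext ⟨m, x⟩
      refine Fin.addCases (fun x => ?_) (fun x => ?_) x <;> simp [g]
    · funext ⟨m, x⟩
      refine Fin.addCases (fun x => ?_) (fun x => ?_) x <;> simp [g]
  · simpa only [hval] using hlim x
  · simpa only [hval] using hab i j hij

/-! ### Combinatorics of consistent patterns -/

/-- The pattern in which an upper bound `m` alternates with a lower bound `t`. -/
def alternation (m t : ℝ) : ℕ → List Letter
  | 0 => []
  | n + 1 => alternation m t n ++ [.lo m, .hi t]

/-- Between the patterns `u` and `v`, arbitrarily long blocks of values at most `a` followed by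
values at least `b` are consistent. -/
def Rise (Cons : List Letter → Prop) (u v : List Letter) (a b : ℝ) : Prop :=
  ∀ K : ℕ, Cons (u ++ (List.replicate K (.lo a) ++ (List.replicate K (.hi b) ++ v)))

/-- Between the patterns `u` and `v`, long blocks of values at least `t'` followed by values at most
`t` are inconsistent. -/
def NoDrop (Cons : List Letter → Prop) (M : ℕ) (u v : List Letter) (t t' : ℝ) : Prop :=
  ¬ Cons (u ++ (List.replicate M (.hi t') ++ (List.replicate M (.lo t) ++ v)))

theorem NoDrop.mono {Cons : List Letter → Prop}
    (hsub : ∀ w w', w.Sublist w' → Cons w' → Cons w)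
    {M M' : ℕ} (hM : M ≤ M') {u u' v v' : List Letter} {t t' : ℝ}
    (hu : u.Sublist u') (hv : v.Sublist v') (h : NoDrop Cons M u v t t') :
    NoDrop Cons M' u' v' t t' := by
  refine fun h' => h (hsub _ _ (hu.append (.append ?_ (.append ?_ hv))) h') <;>
  exact (List.replicate_sublist_replicate _).2 hM

theorem exists_noDrop {Cons : List Letter → Prop}
    (hsub : ∀ w w', w.Sublist w' → Cons w' → Cons w)
    (hlo : ∀ u v a a', a ≤ a' → Cons (u ++ .lo a :: v) → Cons (u ++ .lo a' :: v))
    (halt : ∀ m t, m < t → ∃ N, ¬ Cons (alternation m t N)) {u v : List Letter} {a b t : ℝ}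
    (hat : a < t) (h : Rise Cons u v a b) :
    ∃ u' v' a' t' M, u.Sublist u' ∧ v.Sublist v' ∧ a' < t' ∧ t' < t ∧ Rise Cons u' v' a' b ∧
      NoDrop Cons M u' v' t' t := by
  by_contra! H
  obtain ⟨m, ham, hmt⟩ := exists_between hat
  have key : ∀ N, ∃ u' a', u.Sublist u' ∧ (alternation m t N).Sublist u' ∧ a' < m ∧
      Rise Cons u' v a' b := by
    intro N
    induction N with
    | zero => exact ⟨u, a, .refl _, List.nil_sublist _, ham, h⟩
    | succ N ih =>
      obtain ⟨u', a', hu, hN, ham', hr⟩ := ih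
      obtain ⟨t', hat', htm'⟩ := exists_between ham'
      refine ⟨u' ++ [.lo m, .hi t], t', hu.trans (List.sublist_append_left _ _), hN.append (.refl _),
        htm', fun K => ?_⟩
      have h₁ : Rise Cons (u' ++ [.lo m]) (List.replicate (K + 1) (.hi b) ++ v) a' b := by
        intro K'
        have h₂ := hr (K' + K + 1)
        rw [List.append_assoc]
        refine hlo _ _ a' m ham'.le (hsub _ _ ?_ h₂)
        refine (List.Sublist.refl _).append ?_
        rw [← List.append_assoc (List.replicate K' (Letter.hi b)), ← List.replicate_add]
        change (Letter.lo a' :: List.replicate K' (Letter.lo a') ++ _).Sublist _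
        rw [← List.replicate_succ]
        refine .append ((List.replicate_sublist_replicate _).2 (by omega)) (.append ?_ (.refl _))
        exact (List.replicate_sublist_replicate _).2 (by omega)
      have h₃ := H (u' ++ [.lo m]) (List.replicate (K + 1) (.hi b) ++ v) a' t' (K + 1)
        (hu.trans (List.sublist_append_left _ _)) (List.sublist_append_right _ _) hat'
        (htm'.trans hmt) h₁
      refine hsub _ _ ?_ (not_not.1 h₃)
      rw [List.append_assoc, List.append_assoc]
      refine (List.Sublist.refl _).append (.cons_cons _ ?_)
      rw [List.replicate_succ, List.cons_append]
      refine .cons_cons _ (List.Sublist.trans ?_ (List.sublist_append_right _ _))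
      change (List.replicate K _ ++ (List.replicate K _ ++ v)).Sublist _
      refine .append ?_ (.append ?_ (.refl v)) <;>
      exact (List.replicate_sublist_replicate _).2 (by omega)
  obtain ⟨N, hN⟩ := halt m t hmt
  obtain ⟨u', a', -, hu', -, hr⟩ := key N
  exact hN (hsub _ _ (hu'.trans (List.sublist_append_left _ _)) (hr 0))

theorem exists_noDrop_chain {Cons : List Letter → Prop}
    (hsub : ∀ w w', w.Sublist w' → Cons w' → Cons w)
    (hlo : ∀ u v a a', a ≤ a' → Cons (u ++ .lo a :: v) → Cons (u ++ .lo a' :: v))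
    (halt : ∀ m t, m < t → ∃ N, ¬ Cons (alternation m t N)) {a b : ℝ} (hab : a < b)
    (h : Rise Cons [] [] a b) (n : ℕ) :
    ∃ (u v : List Letter) (a' : ℝ) (t : ℕ → ℝ) (M : ℕ), a' < t 0 ∧ t n = b ∧
      (∀ k < n, t k < t (k + 1)) ∧ Rise Cons u v a' b ∧
      ∀ k < n, NoDrop Cons M u v (t k) (t (k + 1)) := by
  induction n with
  | zero => exact ⟨[], [], a, fun _ => b, 0, hab, rfl, by simp, h, by simp⟩
  | succ n ih =>
    obtain ⟨u, v, a', t, M, hat, htn, ht, hr, hd⟩ := ih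
    obtain ⟨u', v', a'', t', M', hu, hv, hat', htt', hr', hd'⟩ :=
      exists_noDrop hsub hlo halt hat hr
    refine ⟨u', v', a'', fun k => k.casesOn t' t, max M M', hat', htn, fun k hk => ?_, hr',
      fun k hk => ?_⟩
    · rcases k with - | k
      · exact htt'
      · exact ht k (by omega)
    · rcases k with - | k
      · exact hd'.mono hsub (le_max_right _ _) (.refl _) (.refl _)
      · exact (hd k (by omega)).mono hsub (le_max_left _ _) hu hv

/-- An indiscernible sequence can be prolonged by finitely many terms after all others. -/
theorem IsIndiscernible.exists_extend (hM : IsCountablySaturated L M) {ι : Type z} [Finite ι]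
    {a : ℕ → ι → M} (ha : IsIndiscernible L a) (V : ℕ) :
    ∃ d : Fin V → ι → M,
      IsIndiscernible L fun j : ℕ ⊕ₗ Fin V => Sum.elim a d (ofLex j) := by
  have hB : (⋃ i, Set.range (a i)).Countable := Set.countable_iUnion fun i => Set.countable_range _
  have haB : ∀ i x, a i x ∈ ⋃ i, Set.range (a i) := fun i x => Set.mem_iUnion.2 ⟨i, x, rfl⟩
  obtain ⟨d, hd⟩ := hM.exists_tendsto (ι := Fin V × ι) (fun j r => a (j + r.1) r.2)
    (Filter.hyperfilter ℕ) hB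
  refine ⟨fun r x => d (r, x), fun n F hF => ?_⟩
  suffices h : ∀ i : Fin n → ℕ ⊕ₗ Fin V, StrictMono i →
      F (fun r => Sum.elim a (fun r x => d (r, x)) (ofLex (i r.1)) r.2) = F fun r => a r.1 r.2 from
    fun i j hi hj => (h i hi).trans (h j hj).symm
  intro i hi
  let g (r : Fin n × ι) : (Fin V × ι) ⊕ (⋃ i, Set.range (a i) : Set M) :=
    Sum.elim (fun m => .inr ⟨a m r.2, haB m r.2⟩) (fun k => .inl (k, r.2)) (ofLex (i r.1))
  let i' (j : ℕ) (m : Fin n) : ℕ := Sum.elim id (fun k : Fin V => j + k) (ofLex (i m))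
  have hg : ∀ (e : Fin V → ι → M) (r : Fin n × ι),
      Sum.elim (fun z : Fin V × ι => e z.1 z.2) (fun c : (⋃ i, Set.range (a i) : Set M) => (c : M)) (g r) =
        Sum.elim a e (ofLex (i r.1)) r.2 := by
    intro e r
    simp only [g]
    rcases ofLex (i r.1) with m | k <;> rfl
  have h₁ := hd _ (hF.over g)
  have h₂ : ∀ᶠ j in Filter.atTop, StrictMono (i' j) := by
    obtain ⟨N, hN⟩ := (Set.finite_range fun m => Sum.elim id (fun _ => 0) (ofLex (i m))).bddAbove
    filter_upwards [Filter.eventually_gt_atTop N] with j hj m m' hmm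
    have h₃ := hN ⟨m, rfl⟩
    have h₄ := hi hmm
    simp only [i'] at h₃ ⊢
    obtain ⟨y, hy⟩ : ∃ y, i m = toLex y := ⟨ofLex (i m), rfl⟩
    obtain ⟨y', hy'⟩ : ∃ y, i m' = toLex y := ⟨ofLex (i m'), rfl⟩
    rw [hy, hy'] at h₄
    rw [hy] at h₃
    rw [hy, hy', ofLex_toLex, ofLex_toLex]
    rcases y with k | k <;> rcases y' with k' | k'
    · simpa using h₄
    · simp only [ofLex_toLex, Sum.elim_inl, id] at h₃
      simp only [Sum.elim_inl, Sum.elim_inr, id]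
      omega
    · simp at h₄
    · simpa using h₄
  refine tendsto_nhds_unique ?_ (tendsto_const_nhds.congr'
    ((h₂.filter_mono Nat.hyperfilter_le_atTop).mono fun j hj =>
      ha n F hF (fun m => m) (i' j) Fin.val_strictMono hj))
  convert h₁ using 2 with j
  · refine congrArg F (funext fun r => ?_)
    refine Eq.trans ?_ (hg (fun k x => a (j + k) x) r).symm
    simp only [i']
    rcases ofLex (i r.1) with m | k <;> rfl
  · exact congrArg F (funext fun r => (hg (fun k x => d (k, x)) r).symm)

/-! ### Consistent patterns along an indiscernible sequence -/

section Cons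

variable {J : Type*} {p q : ℕ}

/-- The element `x` satisfies the bounds in the list `Q`, up to `η`. -/
def Near (φ : Formula L (Fin p ⊕ Fin q)) (a : J → Fin q → M) (η : ℝ) (x : Fin p → M)
    (Q : List (Letter × J)) : Prop :=
  ∀ z ∈ Q, z.1.viol (φ.val₂ x (a z.2)) ≤ η

/-- The pattern `w` of values of `φ(x, a i)` occurs up to arbitrarily small errors. -/
def Cons (φ : Formula L (Fin p ⊕ Fin q)) (a : ℕ → Fin q → M) (w : List Letter) : Prop :=
  ∀ η : ℝ, 0 < η → ∃ Q : List (Letter × ℕ), Q.map Prod.fst = w ∧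
    (Q.map Prod.snd).Pairwise (· < ·) ∧ ∃ x : Fin p → M, Near φ a η x Q

theorem IsIndiscernible.exists_near [LinearOrder J] {a : J → Fin q → M} (ha : IsIndiscernible L a)
    {φ : Formula L (Fin p ⊕ Fin q)} {Q Q' : List (Letter × J)}
    (hQ : (Q.map Prod.snd).Pairwise (· < ·)) (hQ' : (Q'.map Prod.snd).Pairwise (· < ·))
    (h : Q.map Prod.fst = Q'.map Prod.fst) {η η' : ℝ} (h₀ : 0 ≤ η) (hη : η < η') (h₁ : η' ≤ 1)
    {x : Fin p → M}
    (hx : Near φ a η x Q) : ∃ x' : Fin p → M, Near φ a η' x' Q' := by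
  have hlen : Q'.length = Q.length := by simpa using (congrArg List.length h).symm
  have hmono : ∀ (Q : List (Letter × J)) (n : ℕ) (hn : n = Q.length),
      (Q.map Prod.snd).Pairwise (· < ·) → StrictMono fun m : Fin n => (Q.get (m.cast hn)).2 := by
    rintro Q n rfl hQ m m' hmm
    exact List.pairwise_iff_get.1 (List.pairwise_map.1 hQ) m m' hmm
  obtain ⟨x', hx'⟩ := ha.exists_viol_le φ (fun m : Fin Q.length => (Q.get m).1) h₀ hη h₁
    (hmono Q _ rfl hQ) (hmono Q' _ hlen.symm hQ') (x := x) fun m => hx _ (List.get_mem _ _)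
  refine ⟨x', fun z hz => ?_⟩
  obtain ⟨m, rfl⟩ := List.get_of_mem hz
  have h₂ := hx' (m.cast hlen)
  have h₃ : (Q.get (m.cast hlen)).1 = (Q'.get m).1 := by
    have h₄ : (Q.map Prod.fst)[(m : ℕ)]? = (Q'.map Prod.fst)[(m : ℕ)]? := by rw [h]
    have h₅ : (m : ℕ) < Q.length := hlen ▸ m.2
    simpa [h₅] using h₄
  rw [h₃] at h₂
  exact h₂

variable {φ : Formula L (Fin p ⊕ Fin q)} {a : ℕ → Fin q → M}

theorem Cons.sublist (w w' : List Letter) (h : w.Sublist w') (hw : Cons φ a w') :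
    Cons φ a w := by
  intro η hη
  obtain ⟨Q, rfl, hQ, x, hx⟩ := hw η hη
  obtain ⟨Q', hQ', rfl⟩ := List.sublist_map_iff.1 h
  exact ⟨Q', rfl, hQ.sublist (hQ'.map _), x, fun z hz => hx z (hQ'.subset hz)⟩

theorem Cons.weaken (u v : List Letter) (s s' : ℝ) (hs : s ≤ s')
    (h : Cons φ a (u ++ .lo s :: v)) : Cons φ a (u ++ .lo s' :: v) := by
  intro η hη
  obtain ⟨Q, hQw, hQ, x, hx⟩ := h η hη
  obtain ⟨Q₁, Q₂, rfl, rfl, h₂⟩ := List.map_eq_append_iff.1 hQw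
  obtain ⟨⟨l, i⟩, Q₃, rfl, hl, rfl⟩ := List.map_eq_cons_iff.1 h₂
  refine ⟨Q₁ ++ (.lo s', i) :: Q₃, by simp, by simpa using hQ, x, fun z hz => ?_⟩
  rw [List.mem_append, List.mem_cons] at hz
  rcases hz with hz | rfl | hz
  · exact hx z (List.mem_append_left _ hz)
  · have := hx (l, i) (by simp)
    simp only at hl
    subst hl
    simp only [Letter.viol] at this ⊢
    linarith
  · exact hx z (List.mem_append_right _ (List.mem_cons_of_mem _ hz))

/-- Consistent patterns occur along any sequence that prolongs the given one. -/
theorem Cons.exists_near [LinearOrder J] {c : J → Fin q → M} (hc : IsIndiscernible L c)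
    {f : ℕ → J} (hf : StrictMono f) (hcf : ∀ i, c (f i) = a i) {Q : List (Letter × J)}
    (hQ : (Q.map Prod.snd).Pairwise (· < ·)) (h : Cons φ a (Q.map Prod.fst)) {η : ℝ} (hη : 0 < η) :
    ∃ x : Fin p → M, Near φ c η x Q := by
  wlog h₁ : η ≤ 1 generalizing η
  · exact (this one_pos le_rfl).imp fun x hx z hz => (hx z hz).trans (le_of_not_ge h₁)
  obtain ⟨Q', hQ'w, hQ', x, hx⟩ := h (η / 2) (half_pos hη)
  refine hc.exists_near (Q := Q'.map (Prod.map id f)) ?_ hQ ?_ (half_pos hη).le (half_lt_self hη)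
    h₁ (x := x) fun z hz => ?_
  · rw [List.pairwise_map] at hQ' ⊢
    rw [List.pairwise_map]
    exact hQ'.imp fun h => hf h
  · rw [← hQ'w, List.map_map]
    rfl
  · obtain ⟨z', hz', rfl⟩ := List.mem_map.1 hz
    simpa [hcf] using hx z' hz'

/-- Inconsistent patterns do not occur, even up to a small error, along any sequence that prolongs
the given one. -/
theorem exists_forall_not_near [LinearOrder J] {c : J → Fin q → M} (hc : IsIndiscernible L c)
    {f : ℕ → J} (hf : StrictMono f) (hcf : ∀ i, c (f i) = a i) {w : List Letter}
    (h : ¬ Cons φ a w) : ∃ η : ℝ, 0 < η ∧ ∀ Q : List (Letter × J), Q.map Prod.fst = w →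
      (Q.map Prod.snd).Pairwise (· < ·) → ∀ x : Fin p → M, ¬ Near φ c η x Q := by
  by_contra! H
  refine h fun η hη => ?_
  wlog h₁ : η ≤ 1 generalizing η
  · obtain ⟨Q, hQw, hQ, x, hx⟩ := this 1 one_pos le_rfl
    exact ⟨Q, hQw, hQ, x, fun z hz => (hx z hz).trans (le_of_not_ge h₁)⟩
  obtain ⟨Q, rfl, hQ, x, hx⟩ := H (η / 2) (half_pos hη)
  have hsnd : ((Q.map Prod.fst).zipIdx.map Prod.snd).Pairwise (· < ·) := by
    rw [List.zipIdx_map_snd]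
    exact List.pairwise_lt_range'
  obtain ⟨x', hx'⟩ := hc.exists_near (Q' := (Q.map Prod.fst).zipIdx.map (Prod.map id f)) hQ (by
      rw [List.pairwise_map] at hsnd ⊢
      rw [List.pairwise_map]
      exact hsnd.imp fun h => hf h)
    (by
      rw [List.map_map]
      exact (List.zipIdx_map_fst 0 _).symm) (half_pos hη).le (half_lt_self hη)
    h₁ hx
  refine ⟨_, List.zipIdx_map_fst 0 _, hsnd, x', fun z hz => ?_⟩
  simpa [hcf] using hx' _ (List.mem_map_of_mem hz)

/-- If all values `φ(x, a i)` converge, they do not oscillate infinitely often. -/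
theorem exists_not_cons_alternation (hM : IsCountablySaturated L M) (ha : IsIndiscernible L a)
    (hlim : ∀ x : Fin p → M, ∃ l : ℝ,
      Filter.Tendsto (fun i => φ.val₂ x (a i)) Filter.atTop (nhds l)) (m t : ℝ) (hmt : m < t) :
    ∃ N, ¬ Cons φ a (alternation m t N) := by
  by_contra! H
  let l (k : ℕ) : Letter := if k % 2 = 0 then .lo m else .hi t
  have hl : ∀ N, alternation m t N = (List.range (2 * N)).map l := by
    intro N
    induction N with
    | zero => rfl
    | succ N ih =>
      have h₁ : (2 * N + 1) % 2 = 1 := by omega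
      simp [alternation, ih, mul_add, List.range_succ, l, h₁]
  obtain ⟨x, hx⟩ := hM.exists_viol_le_zero (φ := φ) (a := a) l id (by
    intro s ε hε
    obtain ⟨N, hN⟩ := s.bddAbove
    obtain ⟨x, hx⟩ := Cons.exists_near (φ := φ) ha strictMono_id (fun _ => rfl)
      (Q := (List.range (2 * (N + 1))).map fun k => (l k, k))
      (by simpa [Function.comp_def] using List.pairwise_lt_range)
      (by simpa [Function.comp_def, ← hl] using H (N + 1)) hε
    refine ⟨x, fun k hk => hx (l k, k) (List.mem_map.2 ⟨k, List.mem_range.2 ?_, rfl⟩)⟩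
    have := hN hk
    omega)
  obtain ⟨y, hy⟩ := hlim x
  have h₁ : y ≤ m := le_of_tendsto'
    (hy.comp (Filter.tendsto_id.const_mul_atTop' (r := 2) two_pos)) fun k => by
      simpa [l, Letter.viol] using hx (2 * k)
  have h₂ : t ≤ y := ge_of_tendsto'
    (hy.comp (Filter.tendsto_atTop_mono (fun k => (by omega : k ≤ 2 * k + 1)) Filter.tendsto_id))
      fun k => by
      have h₁ : (2 * k + 1) % 2 = 1 := by omega
      simpa [l, h₁, Letter.viol] using hx (2 * k + 1)
  linarith

/-- An order pattern with a gap yields arbitrarily long blocks of small values followed by large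
values. -/
theorem exists_rise {b : ℕ → Fin p → M} {ε : ℝ} (hε : 0 < ε)
    (hlim : ∀ x : Fin p → M, ∃ l : ℝ,
      Filter.Tendsto (fun i => φ.val₂ x (a i)) Filter.atTop (nhds l))
    (h : ∀ i j, i < j → φ.val₂ (b j) (a i) + ε < φ.val₂ (b i) (a j)) :
    ∃ r s : ℝ, r < s ∧ Rise (Cons φ a) [] [] r s := by
  let U : Ultrafilter ℕ := Filter.hyperfilter ℕ
  have hU : (U : Filter ℕ) ≤ Filter.atTop := Nat.hyperfilter_le_atTop
  have hcpt : ∀ f : ℕ → ℝ, (∀ i, f i ∈ Set.Icc (0 : ℝ) 1) → ∃ l, Filter.Tendsto f U (nhds l) := by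
    intro f hf
    obtain ⟨l, -, hl⟩ := isCompact_Icc.ultrafilter_le_nhds (U.map f)
      (Filter.le_principal_iff.2 (Filter.Eventually.of_forall hf : ∀ᶠ i in (U : Filter ℕ), _))
    exact ⟨l, hl⟩
  choose lim hlim' using fun i => hlim (b i)
  choose m hm using fun i => hcpt (fun j => φ.val₂ (b j) (a i)) fun j => formula_val₂_mem _ _ _
  obtain ⟨l₀, hl₀⟩ := hcpt lim fun i => isClosed_Icc.mem_of_tendsto (hlim' i)
    (Filter.Eventually.of_forall fun j => formula_val₂_mem _ _ _)
  obtain ⟨m₀, hm₀⟩ := hcpt m fun i => isClosed_Icc.mem_of_tendsto (hm i)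
    (Filter.Eventually.of_forall fun j => formula_val₂_mem _ _ _)
  have hml : ∀ i, m i + ε ≤ lim i := fun i =>
    le_of_tendsto_of_tendsto ((hm i).add_const ε) ((hlim' i).mono_left hU)
      (((Filter.eventually_gt_atTop i).filter_mono hU).mono fun j hj => (h i j hj).le)
  have hml₀ : m₀ + ε ≤ l₀ := le_of_tendsto_of_tendsto' (hm₀.add_const ε) hl₀ hml
  refine ⟨m₀ + ε / 3, l₀ - ε / 3, by linarith, fun K η hη => ?_⟩
  have hlow : ∃ᶠ i in Filter.atTop, m i < m₀ + ε / 3 :=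
    ((hm₀.eventually_lt_const (by linarith)).frequently).filter_mono hU
  obtain ⟨i, hi, him⟩ := Filter.extraction_of_frequently_atTop hlow
  have hj₁ : ∀ᶠ j in (U : Filter ℕ), ∀ k ∈ Finset.range K, φ.val₂ (b j) (a (i k)) < m₀ + ε / 3 :=
    (Filter.eventually_all_finset _).2 fun k _ => (hm (i k)).eventually_lt_const (him k)
  have hj₂ : ∀ᶠ j in (U : Filter ℕ), l₀ - ε / 3 < lim j :=
    hl₀.eventually_const_lt (by linarith)
  obtain ⟨j, hj₁, hj₂⟩ := (hj₁.and hj₂).exists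
  obtain ⟨N, hN⟩ := Filter.eventually_atTop.1 ((hlim' j).eventually_const_lt hj₂)
  refine ⟨(List.range K).map (fun k => (.lo (m₀ + ε / 3), i k)) ++
    (List.range K).map (fun k => (.hi (l₀ - ε / 3), max N (i K) + k)), ?_, ?_, b j, ?_⟩
  · simp [Function.comp_def, List.map_const']
  · rw [List.map_append, List.map_map, List.map_map, List.pairwise_append, List.pairwise_map,
      List.pairwise_map]
    refine ⟨List.pairwise_lt_range.imp fun h => hi h, List.pairwise_lt_range.imp fun h => ?_, ?_⟩
    · simpa using h
    · intro x hx y hy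
      obtain ⟨k, hk, rfl⟩ := List.mem_map.1 hx
      obtain ⟨k', hk', rfl⟩ := List.mem_map.1 hy
      have h₁ := hi (List.mem_range.1 hk)
      have h₂ := le_max_right N (i K)
      simp only [Function.comp_apply]
      omega
  · intro z hz
    rcases List.mem_append.1 hz with hz | hz
    · obtain ⟨k, hk, rfl⟩ := List.mem_map.1 hz
      have := hj₁ k (Finset.mem_range.2 (List.mem_range.1 hk))
      simp only [Letter.viol]
      linarith
    · obtain ⟨k, hk, rfl⟩ := List.mem_map.1 hz
      have := hN (max N (i K) + k) ((le_max_left _ _).trans (Nat.le_add_right _ _))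
      simp only [Letter.viol]
      linarith

end Cons

/-! ### Medians -/

/-- The median of `2 * m + 1` elements of the unit interval. -/
noncomputable def median {B : ℕ} (m : ℕ) (y : Fin B → unitInterval) : unitInterval :=
  (Finset.univ.powersetCard (m + 1)).sup fun S => S.inf y

theorem continuous_median {B : ℕ} (m : ℕ) : Continuous (median (B := B) m) :=
  Continuous.finset_sup_apply fun _ _ => Continuous.finset_inf_apply fun i _ => continuous_apply i

section Median

variable {m : ℕ} {y : Fin (2 * m + 1) → unitInterval} {T : ℝ}

theorem exists_card_of_le_median (h : T ≤ median m y) :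
    ∃ S : Finset (Fin (2 * m + 1)), S.card = m + 1 ∧ ∀ i ∈ S, T ≤ y i := by
  obtain ⟨S, hS, hS'⟩ := Finset.exists_mem_eq_sup (Finset.univ.powersetCard (m + 1))
    (Finset.powersetCard_nonempty.2 (by simp; omega)) fun S => S.inf y
  refine ⟨S, (Finset.mem_powersetCard.1 hS).2, fun i hi => h.trans ?_⟩
  rw [median, hS']
  exact Finset.inf_le (f := y) hi

theorem exists_card_of_median_le (h : median m y ≤ T) :
    ∃ S : Finset (Fin (2 * m + 1)), S.card = m + 1 ∧ ∀ i ∈ S, y i ≤ T := by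
  classical
  have h₁ : m + 1 ≤ (Finset.univ.filter fun i => (y i : ℝ) ≤ T).card := by
    by_contra! h₂
    have h₃ := Finset.card_filter_add_card_filter_not (s := (Finset.univ : Finset (Fin (2 * m + 1))))
      (fun i => (y i : ℝ) ≤ T)
    rw [Finset.card_univ, Fintype.card_fin] at h₃
    obtain ⟨S, hS, hS'⟩ := Finset.exists_subset_card_eq
      (show m + 1 ≤ (Finset.univ.filter fun i => ¬ (y i : ℝ) ≤ T).card by omega)
    obtain ⟨i, hi, hi'⟩ := Finset.exists_mem_eq_inf S (Finset.card_pos.1 (by omega)) y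
    have h₄ : (y i : ℝ) ≤ median m y := by
      rw [← hi']
      exact Finset.le_sup (f := fun S : Finset (Fin (2 * m + 1)) => S.inf y)
        (Finset.mem_powersetCard.2 ⟨Finset.subset_univ _, hS'⟩)
    exact (Finset.mem_filter.1 (hS hi)).2 (h₄.trans h)
  obtain ⟨S, hS, hS'⟩ := Finset.exists_subset_card_eq h₁
  exact ⟨S, hS', fun i hi => (Finset.mem_filter.1 (hS hi)).2⟩

theorem le_median (h : ∀ i, T ≤ y i) : T ≤ median m y := by
  by_contra! h₁
  obtain ⟨S, hS, hS'⟩ := exists_card_of_median_le le_rfl (y := y) (m := m)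
  obtain ⟨i, hi⟩ := Finset.card_pos.1 (show 0 < S.card by omega)
  exact absurd (h i) (not_le.2 ((hS' i hi).trans_lt h₁))

theorem median_le (h : ∀ i, y i ≤ T) : median m y ≤ T := by
  by_contra! h₁
  obtain ⟨S, hS, hS'⟩ := exists_card_of_le_median le_rfl (y := y) (m := m)
  obtain ⟨i, hi⟩ := Finset.card_pos.1 (show 0 < S.card by omega)
  exact absurd (h i) (not_le.2 (h₁.trans_le (hS' i hi)))

end Median

/-! ### Ramps -/

/-- The piecewise linear function that is `0` below `s` and `1` above `s'`. -/
noncomputable def ramp (s s' y : ℝ) : ℝ := Set.projIcc (0 : ℝ) 1 zero_le_one ((y - s) / (s' - s))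

theorem continuous_ramp (s s' : ℝ) : Continuous (ramp s s') := by
  unfold ramp
  fun_prop

theorem ramp_nonneg (s s' y : ℝ) : 0 ≤ ramp s s' y := (Set.projIcc (0 : ℝ) 1 _ _).2.1

theorem ramp_le_one (s s' y : ℝ) : ramp s s' y ≤ 1 := (Set.projIcc (0 : ℝ) 1 _ _).2.2

theorem ramp_eq_zero {s s' y : ℝ} (h : s < s') (hy : y ≤ s) : ramp s s' y = 0 := by
  rw [ramp, Set.projIcc_of_le_left]
  exact div_nonpos_of_nonpos_of_nonneg (by linarith) (by linarith)

theorem ramp_eq_one {s s' y : ℝ} (h : s < s') (hy : s' ≤ y) : ramp s s' y = 1 := by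
  rw [ramp, Set.projIcc_of_right_le]
  rw [le_div_iff₀ (by linarith)]
  linarith

/-- A piecewise linear function that increases by `1 / n` between successive levels. -/
noncomputable def stairs (t : ℕ → ℝ) (n : ℕ) (y : ℝ) : unitInterval :=
  Set.projIcc (0 : ℝ) 1 zero_le_one ((∑ k ∈ Finset.range n, ramp (t k) (t (k + 1)) y) / n)

theorem continuous_stairs (t : ℕ → ℝ) (n : ℕ) : Continuous (stairs t n) := by
  unfold stairs
  have := fun k => continuous_ramp (t k) (t (k + 1))
  fun_prop

section Stairs

variable {t : ℕ → ℝ} {n : ℕ}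

theorem level_le (ht : ∀ k < n, t k < t (k + 1)) {k l : ℕ} (hkl : k ≤ l) (hl : l ≤ n) :
    t k ≤ t l := by
  induction l, hkl using Nat.le_induction with
  | base => exact le_rfl
  | succ l hkl ih => exact (ih (by omega)).trans (ht l (by omega)).le

theorem stairs_eq_zero (ht : ∀ k < n, t k < t (k + 1)) {y : ℝ} (hy : y ≤ t 0) :
    stairs t n y = 0 := by
  rw [stairs, projIcc_eq_zero, Finset.sum_eq_zero, zero_div]
  intro k hk
  have hk := Finset.mem_range.1 hk
  exact ramp_eq_zero (ht k hk) (hy.trans (level_le ht (Nat.zero_le k) hk.le))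

theorem stairs_eq_one (ht : ∀ k < n, t k < t (k + 1)) (hn : 0 < n) {y : ℝ} (hy : t n ≤ y) :
    stairs t n y = 1 := by
  have h : ∑ k ∈ Finset.range n, ramp (t k) (t (k + 1)) y = n := by
    rw [Finset.sum_congr rfl (g := fun _ => (1 : ℝ)), Finset.sum_const, Finset.card_range,
      nsmul_eq_mul, mul_one]
    intro k hk
    have hk := Finset.mem_range.1 hk
    exact ramp_eq_one (ht k hk) ((level_le ht hk le_rfl).trans hy)
  rw [stairs, h, div_self (by positivity)]
  exact Set.projIcc_right zero_le_one

theorem stairs_sub_le (ht : ∀ k < n, t k < t (k + 1)) {y y' : ℝ}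
    (h : ∀ k < n, t (k + 1) ≤ y → t k < y') :
    (stairs t n y : ℝ) - stairs t n y' ≤ 2 / n := by
  have h₀ : (0 : ℝ) ≤ 2 / n := by positivity
  have key : ∑ k ∈ Finset.range n, (ramp (t k) (t (k + 1)) y - ramp (t k) (t (k + 1)) y') ≤ 2 := by
    by_cases h₁ : ∀ k < n, ramp (t k) (t (k + 1)) y ≤ ramp (t k) (t (k + 1)) y'
    · refine (Finset.sum_nonpos fun k hk => ?_).trans zero_le_two
      exact sub_nonpos.2 (h₁ k (Finset.mem_range.1 hk))
    push Not at h₁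
    classical
    obtain ⟨hl, hl'⟩ := Nat.find_spec h₁
    have hmin : ∀ k < Nat.find h₁, k < n → ramp (t k) (t (k + 1)) y ≤ ramp (t k) (t (k + 1)) y' :=
      fun k hk hkn => not_lt.1 fun h' => Nat.find_min h₁ hk ⟨hkn, h'⟩
    generalize Nat.find h₁ = l at hl hl' hmin
    have hy' : y' < t (l + 1) := by
      by_contra! h₂
      rw [ramp_eq_one (ht l hl) h₂] at hl'
      exact absurd hl' (ramp_le_one _ _ _).not_gt
    have hterm : ∀ k ∈ Finset.range n, ramp (t k) (t (k + 1)) y - ramp (t k) (t (k + 1)) y' ≤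
        (if k = l then 1 else 0) + (if k = l + 1 then 1 else 0) := by
      intro k hk
      have hk := Finset.mem_range.1 hk
      have h₂ := ramp_le_one (t k) (t (k + 1)) y
      have h₃ := ramp_nonneg (t k) (t (k + 1)) y'
      rcases lt_trichotomy k l with hkl | rfl | hkl
      · have := hmin k hkl hk
        rw [if_neg (by omega), if_neg (by omega)]
        linarith
      · rw [if_pos rfl, if_neg (by omega)]
        linarith
      · rcases (Nat.succ_le_of_lt hkl).eq_or_lt with rfl | hkl'
        · rw [if_neg (by omega), if_pos rfl]
          linarith
        · have h₄ : y < t (l + 2) := by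
            by_contra! h₄
            exact absurd (h (l + 1) (by omega) h₄) hy'.not_gt
          have h₅ := ramp_eq_zero (ht k hk) (h₄.le.trans (level_le ht hkl' hk.le))
          rw [if_neg (by omega), if_neg (by omega)]
          linarith
    refine (Finset.sum_le_sum hterm).trans ?_
    rw [Finset.sum_add_distrib, Finset.sum_ite_eq', Finset.sum_ite_eq']
    split_ifs <;> norm_num
  rw [Finset.sum_sub_distrib] at key
  have hdiv : (∑ k ∈ Finset.range n, ramp (t k) (t (k + 1)) y) / n ≤
      (∑ k ∈ Finset.range n, ramp (t k) (t (k + 1)) y') / n + 2 / n := by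
    rw [← add_div]
    gcongr
    linarith
  have hpos : (0 : ℝ) ≤ (∑ k ∈ Finset.range n, ramp (t k) (t (k + 1)) y') / n :=
    div_nonneg (Finset.sum_nonneg fun k _ => ramp_nonneg _ _ _) (Nat.cast_nonneg n)
  rw [stairs, stairs, Set.coe_projIcc, Set.coe_projIcc]
  rw [max_eq_right (le_min zero_le_one hpos), max_eq_right]
  · rcases min_cases 1 ((∑ k ∈ Finset.range n, ramp (t k) (t (k + 1)) y') / n) with h₂ | h₂
    · rw [h₂.1]
      linarith [min_le_left 1 ((∑ k ∈ Finset.range n, ramp (t k) (t (k + 1)) y) / n)]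
    · rw [h₂.1]
      linarith [min_le_right 1 ((∑ k ∈ Finset.range n, ramp (t k) (t (k + 1)) y) / n)]
  · exact le_min zero_le_one
      (div_nonneg (Finset.sum_nonneg fun k _ => ramp_nonneg _ _ _) (Nat.cast_nonneg n))

end Stairs

/-! ### Combinations -/

/-- A continuous function of the values `φ(x, y j)` for a finite block of tuples of variables `y j`
and of the values `φ(x, d i)` for finitely many tuples of parameters `d i` is a combination. -/
theorem exists_combination {q B : ℕ} {D : Type} [Fintype D] (d : D → Fin q → M)
    {Θ : (Fin B ⊕ D → unitInterval) → unitInterval} (hΘ : Continuous Θ) :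
    ∃ C : Combination M q (B * q),
      (∀ i, ∃ m r, C.params i = d m r) ∧
      ∀ {p : ℕ} (φ : Formula L (Fin p ⊕ Fin q)) (x : Fin p → M) (A : Fin (B * q) → M),
        C.val φ x A = Θ (Sum.elim
          (fun j => φ.val (Sum.elim x fun r => A (finProdFinEquiv (j, r))))
          fun m => φ.val (Sum.elim x (d m))) := by
  let eP := Fintype.equivFin (D × Fin q)
  let eI := Fintype.equivFin (Fin B ⊕ D)
  refine ⟨⟨_, fun i => d (eP.symm i).1 (eP.symm i).2, _,
    fun l r => (eI.symm l).elim (fun j => .inl (finProdFinEquiv (j, r))) fun m => .inr (eP (m, r)),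
    ⟨fun y => Θ (y ∘ eI), by fun_prop⟩⟩, fun i => ⟨_, _, rfl⟩, fun φ x A => ?_⟩
  refine congrArg (fun y => (Θ y : ℝ)) (funext fun l => ?_)
  rcases l with j | m <;> simp

/-! ### Blocks between two finite tuples of parameters -/

theorem strictMono_addCases {J : Type*} [Preorder J] {m n : ℕ} {f : Fin m → J} {g : Fin n → J}
    (hf : StrictMono f) (hg : StrictMono g) (hfg : ∀ i j, f i < g j) :
    StrictMono (Fin.addCases f g : Fin (m + n) → J) := by
  intro i j
  refine Fin.addCases (fun i => ?_) (fun i => ?_) i <;>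
    refine Fin.addCases (fun j => ?_) (fun j => ?_) j <;> intro hij
  · simpa using hf ((Fin.strictMono_castAdd n).lt_iff_lt.1 hij)
  · simpa using hfg i j
  · exact absurd hij (by simp [Fin.lt_def]; omega)
  · simpa using hg ((Fin.strictMono_natAdd m).lt_iff_lt.1 hij)

theorem add_mul_add_lt {i i' B : ℕ} (h : i < i') (j j' : Fin B) : i * B + j < i' * B + j' := by
  have h₁ : (i + 1) * B ≤ i' * B := Nat.mul_le_mul_right B h
  have h₂ := j.2
  rw [add_mul, one_mul] at h₁
  omega

/-- Consecutive blocks of an indiscernible sequence are indiscernible over the initial and the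
final terms. -/
theorem IsIndiscernible.blocks {J : Type*} [LinearOrder J] {q : ℕ} {c : J → Fin q → M}
    (hc : IsIndiscernible L c) {f : ℕ → J} (hf : StrictMono f) (U B : ℕ) {V : ℕ} {g : Fin V → J}
    (hg : StrictMono g) (hfg : ∀ i j, f i < g j) {A : Set M}
    (hA : ∀ y ∈ A, (∃ m < U, ∃ r, y = c (f m) r) ∨ ∃ m r, y = c (g m) r) :
    IsIndiscernibleOver L A fun (i : ℕ) (z : Fin (B * q)) =>
      c (f (U + (i * B + (finProdFinEquiv.symm z).1))) (finProdFinEquiv.symm z).2 := by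
  intro n i i' hi hi' χ
  let pos (i : Fin n → ℕ) : Fin (U + (n * B + V)) → J :=
    Fin.addCases (fun m => f m)
      (Fin.addCases (fun s => f (U + (i (finProdFinEquiv.symm s).1 * B + (finProdFinEquiv.symm s).2)))
        g)
  have hpos : ∀ i : Fin n → ℕ, StrictMono i → StrictMono (pos i) := by
    intro i hi
    refine strictMono_addCases (hf.comp Fin.val_strictMono) (strictMono_addCases ?_ hg ?_) ?_
    · intro s s' hs
      refine hf (Nat.add_lt_add_left ?_ U)
      obtain ⟨⟨x, y⟩, rfl⟩ := finProdFinEquiv.surjective s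
      obtain ⟨⟨x', y'⟩, rfl⟩ := finProdFinEquiv.surjective s'
      simp only [Equiv.symm_apply_apply]
      have hs : (y : ℕ) + B * x < y' + B * x' := hs
      rcases lt_trichotomy x x' with h | rfl | h
      · exact add_mul_add_lt (hi h) y y'
      · omega
      · have := add_mul_add_lt (Fin.lt_def.1 h) y' y
        rw [mul_comm B, mul_comm B] at hs
        omega
    · exact fun s m => hfg _ _
    · intro m s
      refine Fin.addCases (fun s => ?_) (fun s => ?_) s
      · simp only [Fin.addCases_left]
        exact hf (by omega)
      · simpa using hfg _ _
  have hA' : ∀ y : A, ∃ (k : Fin (U + (n * B + V))) (r : Fin q), ∀ i, (y : M) = c (pos i k) r := by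
    rintro ⟨y, hy⟩
    rcases hA y hy with ⟨m, hm, r, rfl⟩ | ⟨m, r, rfl⟩
    · exact ⟨Fin.castAdd _ ⟨m, hm⟩, r, fun i => by simp only [pos, Fin.addCases_left]⟩
    · exact ⟨Fin.natAdd _ (Fin.natAdd _ m), r, fun i => by simp [pos]⟩
  choose k r hkr using hA'
  let h : (Fin n × Fin (B * q)) ⊕ A → Fin (U + (n * B + V)) × Fin q := Sum.elim
    (fun z => (Fin.natAdd U (Fin.castAdd V (finProdFinEquiv (z.1, (finProdFinEquiv.symm z.2).1))),
      (finProdFinEquiv.symm z.2).2)) fun y => (k y, r y)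
  have key : ∀ i : Fin n → ℕ, (fun z => c (pos i z.1) z.2) ∘ h =
      Sum.elim (fun z : Fin n × Fin (B * q) =>
        c (f (U + (i z.1 * B + (finProdFinEquiv.symm z.2).1))) (finProdFinEquiv.symm z.2).2)
        fun y : A => (y : M) := by
    intro i
    funext z
    rcases z with z | y
    · simp only [Function.comp_apply, h, pos, Sum.elim_inl, Fin.addCases_right, Fin.addCases_left,
        Equiv.symm_apply_apply]
    · exact (hkr y i).symm
  rw [← key, ← key]
  exact hc _ _ (χ.isDefinable.comp h) _ _ (hpos i hi) (hpos i' hi')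

section Frame

variable {J : Type*} {u v : List Letter} {f : ℕ → J} {g : Fin v.length → J}

/-- The bounds `u` at the first positions, `v` at the last positions, and `mid` between them. -/
def frame (u v : List Letter) (f : ℕ → J) (g : Fin v.length → J) (mid : List (Letter × ℕ)) :
    List (Letter × J) :=
  List.ofFn (fun m : Fin u.length => (u.get m, f m)) ++
    (mid.map (Prod.map id f) ++ List.ofFn fun m => (v.get m, g m))

theorem frame_map_fst (mid : List (Letter × ℕ)) :
    (frame u v f g mid).map Prod.fst = u ++ (mid.map Prod.fst ++ v) := by
  have h : ∀ w : List Letter, List.ofFn (fun m : Fin w.length => w[(m : ℕ)]) = w :=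
    fun w => List.ofFn_getElem
  simp [frame, List.map_ofFn, Function.comp_def, h]

theorem frame_pairwise [LinearOrder J] (hf : StrictMono f) (hg : StrictMono g)
    (hfg : ∀ i j, f i < g j) {mid : List (Letter × ℕ)}
    (h : (mid.map Prod.snd).Pairwise (· < ·)) (hU : ∀ z ∈ mid, u.length ≤ z.2) :
    ((frame u v f g mid).map Prod.snd).Pairwise (· < ·) := by
  simp only [frame, List.map_append, List.map_ofFn, List.map_map]
  refine List.pairwise_append.2 ⟨?_, List.pairwise_append.2 ⟨?_, ?_, ?_⟩, ?_⟩
  · exact List.pairwise_ofFn.2 fun i j hij => hf hij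
  · rw [List.pairwise_map] at h ⊢
    exact h.imp fun h => hf h
  · exact List.pairwise_ofFn.2 fun i j hij => hg hij
  · intro x hx y hy
    obtain ⟨z, -, rfl⟩ := List.mem_map.1 hx
    obtain ⟨m, rfl⟩ := (List.mem_ofFn' _ _).1 hy
    exact hfg _ _
  · intro x hx y hy
    obtain ⟨m, rfl⟩ := (List.mem_ofFn' _ _).1 hx
    rcases List.mem_append.1 hy with hy | hy
    · obtain ⟨z, hz, rfl⟩ := List.mem_map.1 hy
      exact hf (m.2.trans_le (hU z hz))
    · obtain ⟨m, rfl⟩ := (List.mem_ofFn' _ _).1 hy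
      exact hfg _ _

theorem mem_frame {mid : List (Letter × ℕ)} {z : Letter × J} :
    z ∈ frame u v f g mid ↔ (∃ m : Fin u.length, (u.get m, f m) = z) ∨
      (∃ y ∈ mid, (y.1, f y.2) = z) ∨ ∃ m, (v.get m, g m) = z := by
  simp only [frame, List.mem_append, List.mem_map, List.mem_ofFn', Set.mem_range]
  rfl

end Frame

/-! ### From failure of sequential completeness to the weak strict order property -/

/-- The position of a parameter. -/
def framePos {J : Type*} {U V : ℕ} (f : ℕ → J) (g : Fin V → J) : Fin U ⊕ Fin V → J :=
  Sum.elim (fun m => f m) g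

section Witness

variable {J : Type*} [LinearOrder J] {p q : ℕ} {φ : Formula L (Fin p ⊕ Fin q)}
  {a : ℕ → Fin q → M} {c : J → Fin q → M} {u v : List Letter} {f : ℕ → J} {g : Fin v.length → J}

/-- A block of small values followed by large values is realized between the parameters. -/
theorem Rise.exists_realization (hM : IsCountablySaturated L M) (hc : IsIndiscernible L c)
    (hf : StrictMono f) (hcf : ∀ i, c (f i) = a i) (hg : StrictMono g) (hfg : ∀ i j, f i < g j)
    {s t : ℝ} (h : Rise (Cons φ a) u v s t) (N : ℕ) :
    ∃ x : Fin p → M,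
      (∀ r, (Sum.elim u.get v.get r).viol (φ.val₂ x (c (framePos f g r))) ≤ 0) ∧
      (∀ k < N, φ.val₂ x (c (f (u.length + k))) ≤ s) ∧
      ∀ k, N ≤ k → t ≤ φ.val₂ x (c (f (u.length + k))) := by
  let l (k : ℕ) : Letter := if k < N then .lo s else .hi t
  obtain ⟨x, hx⟩ := hM.exists_viol_le_zero (φ := φ) (a := c)
    (Sum.elim (Sum.elim u.get v.get) l) (Sum.elim (framePos f g) fun k => f (u.length + k)) (by
      intro F ε hε
      classical
      obtain ⟨K, hK⟩ := (F.image (Sum.elim (fun _ => 0) id)).bddAbove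
      let mid : List (Letter × ℕ) := (List.range N).map (fun k => (.lo s, u.length + k)) ++
        (List.range (K + 1)).map (fun k => (.hi t, u.length + (N + k)))
      have hsorted : (mid.map Prod.snd).Pairwise (· < ·) := by
        simp only [mid, List.map_append, List.map_map]
        refine List.pairwise_append.2 ⟨?_, ?_, ?_⟩
        · exact List.pairwise_map.2 (List.pairwise_lt_range.imp fun h => Nat.add_lt_add_left h _)
        · refine List.pairwise_map.2 (List.pairwise_lt_range.imp fun h => ?_)
          exact Nat.add_lt_add_left (Nat.add_lt_add_left h _) _
        · intro x hx y hy
          obtain ⟨k, hk, rfl⟩ := List.mem_map.1 hx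
          obtain ⟨k', hk', rfl⟩ := List.mem_map.1 hy
          have := List.mem_range.1 hk
          simp only [Function.comp_apply]
          omega
      have hU : ∀ z ∈ mid, u.length ≤ z.2 := by
        intro z hz
        rcases List.mem_append.1 hz with hz | hz <;>
        · obtain ⟨k, -, rfl⟩ := List.mem_map.1 hz
          exact Nat.le_add_right _ _
      have hcons : Cons φ a ((frame u v f g mid).map Prod.fst) := by
        rw [frame_map_fst]
        refine Cons.sublist _ _ ?_ (h (max N (K + 1)))
        simp only [mid, List.map_append, List.map_map, Function.comp_def, List.map_const',
          List.length_range, List.append_assoc]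
        refine (List.Sublist.refl _).append (.append ?_ (.append ?_ (.refl v)))
        · exact (List.replicate_sublist_replicate _).2 (le_max_left _ _)
        · exact (List.replicate_sublist_replicate _).2 (le_max_right _ _)
      obtain ⟨x, hx⟩ := hcons.exists_near hc hf hcf (frame_pairwise hf hg hfg hsorted hU) hε
      refine ⟨x, fun k hk => ?_⟩
      rcases k with (m | m) | k
      · exact hx _ (mem_frame.2 (.inl ⟨m, rfl⟩))
      · exact hx _ (mem_frame.2 (.inr (.inr ⟨m, rfl⟩)))
      · have hkK : k ≤ K := hK (Finset.mem_coe.2 (Finset.mem_image_of_mem _ hk))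
        refine hx (l k, f (u.length + k)) (mem_frame.2 (.inr (.inl ⟨(l k, u.length + k), ?_, rfl⟩)))
        by_cases hkN : k < N
        · simp [mid, l, hkN]
        · refine List.mem_append_right _ (List.mem_map.2 ⟨k - N, List.mem_range.2 (by omega), ?_⟩)
          simp only [l, hkN, if_false]
          congr 2
          omega)
  refine ⟨x, fun r => hx (.inl r), fun k hk => ?_, fun k hk => ?_⟩
  · simpa [l, hk, Letter.viol] using hx (.inr k)
  · simpa [l, not_lt.2 hk, Letter.viol] using hx (.inr k)

/-- If the bounds at the parameters are almost satisfied and drops of values over long blocks are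
inconsistent, then the medians of successive blocks do not drop. -/
theorem median_lt_of_not_near (hf : StrictMono f) (hg : StrictMono g) (hfg : ∀ i j, f i < g j)
    {m : ℕ} {s s' η : ℝ} (hη : 0 ≤ η) {x : Fin p → M}
    (h : ∀ Q : List (Letter × J), Q.map Prod.fst = u ++ (List.replicate (m + 1) (.hi s') ++
        (List.replicate (m + 1) (.lo s) ++ v)) →
      (Q.map Prod.snd).Pairwise (· < ·) → ¬ Near φ c η x Q)
    (hx : ∀ r, (Sum.elim u.get v.get r).viol (φ.val₂ x (c (framePos f g r))) ≤ η) (i : ℕ)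
    (hi : s' ≤ median m fun j : Fin (2 * m + 1) =>
      φ.val (Sum.elim x (c (f (u.length + (i * (2 * m + 1) + j)))))) :
    s < median m fun j : Fin (2 * m + 1) =>
      φ.val (Sum.elim x (c (f (u.length + ((i + 1) * (2 * m + 1) + j))))) := by
  by_contra! hi'
  obtain ⟨S, hS, hS'⟩ := exists_card_of_le_median hi
  obtain ⟨T, hT, hT'⟩ := exists_card_of_median_le hi'
  let mid : List (Letter × ℕ) :=
    (S.sort (· ≤ ·)).map (fun j : Fin (2 * m + 1) => (.hi s', u.length + (i * (2 * m + 1) + j))) ++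
      (T.sort (· ≤ ·)).map (fun j : Fin (2 * m + 1) => (.lo s, u.length + ((i + 1) * (2 * m + 1) + j)))
  have hsorted : (mid.map Prod.snd).Pairwise (· < ·) := by
    simp only [mid, List.map_append, List.map_map]
    refine List.pairwise_append.2 ⟨?_, ?_, ?_⟩
    · refine List.pairwise_map.2 ((Finset.sortedLT_sort S).pairwise.imp fun h => ?_)
      exact Nat.add_lt_add_left (Nat.add_lt_add_left h _) _
    · refine List.pairwise_map.2 ((Finset.sortedLT_sort T).pairwise.imp fun h => ?_)
      exact Nat.add_lt_add_left (Nat.add_lt_add_left h _) _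
    · intro x hx y hy
      obtain ⟨k, -, rfl⟩ := List.mem_map.1 hx
      obtain ⟨k', -, rfl⟩ := List.mem_map.1 hy
      exact Nat.add_lt_add_left (add_mul_add_lt (Nat.lt_succ_self i) k k') _
  have hU : ∀ z ∈ mid, u.length ≤ z.2 := by
    intro z hz
    rcases List.mem_append.1 hz with hz | hz <;>
    · obtain ⟨k, -, rfl⟩ := List.mem_map.1 hz
      exact Nat.le_add_right _ _
  refine h (frame u v f g mid) ?_ (frame_pairwise hf hg hfg hsorted hU) fun z hz => ?_
  · rw [frame_map_fst]
    simp [mid, Function.comp_def, List.map_const', hS, hT]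
  · rcases mem_frame.1 hz with ⟨r, rfl⟩ | ⟨y, hy, rfl⟩ | ⟨r, rfl⟩
    · exact hx (.inl r)
    · rcases List.mem_append.1 hy with hy | hy
      · obtain ⟨k, hk, rfl⟩ := List.mem_map.1 hy
        exact le_trans (sub_nonpos.2 (hS' k ((Finset.mem_sort _).1 hk))) hη
      · obtain ⟨k, hk, rfl⟩ := List.mem_map.1 hy
        exact le_trans (sub_nonpos.2 (hT' k ((Finset.mem_sort _).1 hk))) hη
    · exact hx (.inr r)

end Witness

theorem FormulaNSCP.formulaWSOP (hM : IsCountablySaturated L M) {p q : ℕ}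
    {φ : Formula L (Fin p ⊕ Fin q)} (h : FormulaNSCP M φ) : FormulaWSOP M φ := by
  obtain ⟨a, b, ε, hε, ha, hlim, hab⟩ := h
  rw [isIndiscernibleOver_empty_iff] at ha
  obtain ⟨r, s, hrs, hr⟩ := exists_rise hε hlim hab
  refine ⟨1 / 2, by norm_num, fun n hn => ?_⟩
  obtain ⟨u, v, a', t, m, hat, htn, ht, hrise, hdrop⟩ := exists_noDrop_chain Cons.sublist Cons.weaken
    (exists_not_cons_alternation hM ha hlim) hrs hr (4 * n)
  obtain ⟨d, hc⟩ := ha.exists_extend hM v.length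
  set c : ℕ ⊕ₗ Fin v.length → Fin q → M := fun j => Sum.elim a d (ofLex j) with hcdef
  let f (i : ℕ) : ℕ ⊕ₗ Fin v.length := toLex (.inl i)
  let g (i : Fin v.length) : ℕ ⊕ₗ Fin v.length := toLex (.inr i)
  have hf : StrictMono f := fun i j hij => Sum.Lex.inl_lt_inl_iff.2 hij
  have hg : StrictMono g := fun i j hij => Sum.Lex.inr_lt_inr_iff.2 hij
  have hfg : ∀ i j, f i < g j := fun i j => Sum.Lex.inl_lt_inr _ _
  have hcf : ∀ i, c (f i) = a i := fun i => rfl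
  obtain ⟨η, hη, hnear⟩ : ∃ η : ℝ, 0 < η ∧ ∀ k < 4 * n, ∀ Q : List (Letter × (ℕ ⊕ₗ Fin v.length)),
      Q.map Prod.fst = u ++ (List.replicate (m + 1) (.hi (t (k + 1))) ++
        (List.replicate (m + 1) (.lo (t k)) ++ v)) →
      (Q.map Prod.snd).Pairwise (· < ·) → ∀ x : Fin p → M, ¬ Near φ c η x Q := by
    have hk : ∀ k < 4 * n, _ := fun k hk => exists_forall_not_near (L := L) (φ := φ) hc hf hcf
      ((hdrop k hk).mono (Cons.sublist (φ := φ)) (Nat.le_succ m) (.refl u) (.refl v))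
    choose! η hη hη' using hk
    have h₁ : ∀ᶠ y in nhdsWithin (0 : ℝ) (Set.Ioi 0), ∀ k ∈ Finset.range (4 * n), y < η k :=
      (Filter.eventually_all_finset _).2 fun k hk =>
        nhdsWithin_le_nhds (eventually_lt_nhds (hη k (Finset.mem_range.1 hk)))
    obtain ⟨y, hy, hy₀⟩ := (h₁.and self_mem_nhdsWithin).exists
    refine ⟨y, hy₀, fun k hk Q hQ hQ' x hx => hη' k hk Q hQ hQ' x fun z hz => ?_⟩
    exact (hx z hz).trans (hy k (Finset.mem_range.2 hk)).le
  let pos : Fin u.length ⊕ Fin v.length → ℕ ⊕ₗ Fin v.length := framePos f g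
  let defect (y : Fin u.length ⊕ Fin v.length → unitInterval) : unitInterval :=
    Finset.univ.sup fun r =>
      Set.projIcc (0 : ℝ) 1 zero_le_one ((Sum.elim u.get v.get r).viol (y r) / η)
  have hdefect : Continuous defect := Continuous.finset_sup_apply fun r _ => by
    have := (Sum.elim u.get v.get r).continuous_viol
    fun_prop
  have hΘ : Continuous fun y : Fin (2 * m + 1) ⊕ (Fin u.length ⊕ Fin v.length) → unitInterval =>
      max (stairs t (4 * n) (median m (y ∘ Sum.inl))) (defect (y ∘ Sum.inr)) := by
    have h₁ := continuous_stairs t (4 * n)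
    have h₂ := continuous_median (B := 2 * m + 1) m
    fun_prop
  obtain ⟨C, hC, hCval⟩ := exists_combination (L := L) (fun r => c (pos r)) hΘ
  let A (i : ℕ) (z : Fin ((2 * m + 1) * q)) : M :=
    c (f (u.length + (i * (2 * m + 1) + (finProdFinEquiv.symm z).1))) (finProdFinEquiv.symm z).2
  let med (x : Fin p → M) (i : ℕ) : unitInterval := median m fun j : Fin (2 * m + 1) =>
    φ.val (Sum.elim x (c (f (u.length + (i * (2 * m + 1) + j)))))
  let df (x : Fin p → M) : unitInterval := defect fun r => φ.val (Sum.elim x (c (pos r)))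
  have hval : ∀ x i, C.val φ x (A i) = max (stairs t (4 * n) (med x i) : ℝ) (df x) := by
    intro x i
    rw [hCval]
    simp only [A, Sum.elim_comp_inl, Sum.elim_comp_inr, Equiv.symm_apply_apply]
    rfl
  have hreal := fun N => hrise.exists_realization hM hc hf hcf hg hfg (N * (2 * m + 1))
  choose x hxpar hxlo hxhi using hreal
  have hx₀ : ∀ i j, i < j → C.val φ (x j) (A i) = 0 := by
    intro i j hij
    have h₁ : (med (x j) i : ℝ) ≤ a' := median_le fun k =>
      hxlo j _ (by simpa using add_mul_add_lt hij k (0 : Fin (2 * m + 1)))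
    have h₂ : df (x j) = 0 := (Finset.sup_eq_bot_iff _ _).2 fun r _ =>
      projIcc_eq_zero.2 (div_nonpos_of_nonpos_of_nonneg (hxpar j r) hη.le)
    rw [hval, stairs_eq_zero ht (h₁.trans hat.le), h₂]
    simp
  have hx₁ : ∀ i j, j ≤ i → C.val φ (x j) (A i) = 1 := by
    intro i j hij
    have h₁ : s ≤ med (x j) i := le_median fun k =>
      hxhi j _ ((Nat.mul_le_mul_right _ hij).trans (Nat.le_add_right _ _))
    rw [hval, stairs_eq_one ht (by omega) (htn.trans_le h₁)]
    simpa using (df (x j)).2.2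
  refine ⟨_, C, A, x, ?_, fun y => ?_, fun i y => ?_, fun i j hij => ?_⟩
  · refine hc.blocks hf u.length (2 * m + 1) hg hfg ?_
    rintro _ ⟨l, rfl⟩
    obtain ⟨k | k, r, hk⟩ := hC l
    · exact .inl ⟨k, k.2, r, hk⟩
    · exact .inr ⟨k, r, hk⟩
  · obtain ⟨l, hl⟩ := hlim y
    have hl₁ : l ∈ Set.Icc (0 : ℝ) 1 := isClosed_Icc.mem_of_tendsto hl
      (Filter.Eventually.of_forall fun i => formula_val₂_mem φ y (a i))
    have hl₂ : Filter.Tendsto (fun i => φ.val (Sum.elim y (a i))) Filter.atTop (nhds ⟨l, hl₁⟩) :=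
      tendsto_subtype_rng.2 hl
    have h₁ : Filter.Tendsto (fun i (j : Fin (2 * m + 1)) =>
        φ.val (Sum.elim y (c (f (u.length + (i * (2 * m + 1) + j)))))) Filter.atTop
        (nhds fun _ => ⟨l, hl₁⟩) := by
      refine tendsto_pi_nhds.2 fun j => hl₂.comp (Filter.tendsto_atTop_mono (fun i => ?_)
        Filter.tendsto_id)
      have := Nat.le_mul_of_pos_right i (Nat.succ_pos (2 * m))
      simp only [id, Nat.succ_eq_add_one] at this ⊢
      omega
    have h₂ : Continuous fun z : Fin (2 * m + 1) → unitInterval =>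
        max (stairs t (4 * n) (median m z) : ℝ) (df y) := by
      exact (continuous_subtype_val.comp ((continuous_stairs t (4 * n)).comp
        (continuous_subtype_val.comp (continuous_median m)))).max continuous_const
    simp only [hval]
    exact ⟨_, (h₂.tendsto _).comp h₁⟩
  · have hn' : (0 : ℝ) < n := by exact_mod_cast hn
    refine max_le ?_ (by positivity)
    rw [hval, hval]
    by_cases hy : df y = 1
    · have h₁ : ∀ z : unitInterval, max (z : ℝ) (df y) = 1 := fun z => by
        rw [hy]
        exact max_eq_right z.2.2
      rw [h₁, h₁, sub_self]
      positivity
    · have hpar : ∀ r, (Sum.elim u.get v.get r).viol (φ.val₂ y (c (framePos f g r))) ≤ η := by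
        intro r
        by_contra! h₁
        refine hy (le_antisymm (df y).2.2 ?_)
        refine le_trans (le_of_eq ?_) (Finset.le_sup (f := fun r => Set.projIcc (0 : ℝ) 1 zero_le_one
          ((Sum.elim u.get v.get r).viol (φ.val₂ y (c (framePos f g r))) / η)) (Finset.mem_univ r))
        refine (Set.projIcc_of_right_le zero_le_one ?_).symm
        rw [le_div_iff₀ hη]
        linarith
      have h₂ := stairs_sub_le ht (y := med y i) (y' := med y (i + 1)) fun k hk hki =>
        median_lt_of_not_near hf hg hfg hη.le (fun Q hQ hQ2 => hnear k hk Q hQ hQ2 y) hpar i hki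
      have h₃ : (2 : ℝ) / (4 * n : ℕ) = 1 / 2 / n := by
        push_cast
        field_simp
        norm_num
      rw [h₃] at h₂
      have h₄ : (0 : ℝ) ≤ 1 / 2 / n := by positivity
      rw [sub_le_iff_le_add]
      refine max_le ?_ ?_
      · linarith [le_max_left (stairs t (4 * n) (med y (i + 1)) : ℝ) (df y)]
      · linarith [le_max_right (stairs t (4 * n) (med y (i + 1)) : ℝ) (df y)]
  · rw [hx₀ i j hij, hx₁ j i hij.le]
    norm_num

theorem hasWSOP_iff_hasNSCP (hM : IsCountablySaturated L M) : HasWSOP L M ↔ HasNSCP L M :=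
  ⟨HasWSOP.hasNSCP, fun ⟨p, q, φ, h⟩ => ⟨p, q, φ, h.formulaWSOP hM⟩⟩

theorem hasOP_iff (hM : IsCountablySaturated L M) : HasOP L M ↔ HasIP L M ∨ HasWSOP L M := by
  rw [hasWSOP_iff_hasNSCP hM]
  refine ⟨fun h => or_iff_not_imp_left.2 fun hIP => hasNSCP_of_hasOP hM hIP h, ?_⟩
  rintro (⟨p, q, φ, h⟩ | ⟨p, q, φ, h⟩)
  · exact ⟨p, q, φ, h.formulaOP⟩
  · exact ⟨p, q, φ, h.formulaOP⟩

end ContLogic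

theorem mainTheorem1 (L : ContLogic.Language.{u, v}) (T : ContLogic.Theory L)
    (hT : ContLogic.Theory.IsComplete.{u, v, w} T)
    (𝒰 : Type w) [MetricSpace 𝒰] [ContLogic.Structure L 𝒰] (h𝒰 : ContLogic.IsMonsterModel T 𝒰) :
    (ContLogic.IsNIP L 𝒰 ∧ ContLogic.IsNwSOP L 𝒰 → ContLogic.IsStable L 𝒰) ∧
    (ContLogic.IsNwSOP L 𝒰 ↔ ContLogic.IsSCP L 𝒰) ∧
    (ContLogic.HasOP L 𝒰 ↔ ContLogic.HasIP L 𝒰 ∨ ContLogic.HasWSOP L 𝒰) := by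
  have hM := h𝒰.isCountablySaturated
  refine ⟨fun ⟨hIP, hSOP⟩ p q φ hφ => ?_, not_congr (ContLogic.hasWSOP_iff_hasNSCP hM),
    ContLogic.hasOP_iff hM⟩
  exact ((ContLogic.hasOP_iff hM).1 ⟨p, q, φ, hφ⟩).elim hIP hSOP
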